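/- Let $d\ge 2$ and let $\Omega\subset\mathbb R^d$ be a non-empty, bounded, connected open set. Let $H^1_0(\Omega)$ be the closure of $C_c^\infty(\Omega)$ in $H^1(\Omega)$. Let $\lambda_1(\Omega)$ be the first Dirichlet eigenvalue of $\Omega$, i.e. the smallest $\lambda\in\mathbb R$ for which there is $u\in H^1_0(\Omega)$, $u\not\equiv 0$, with $-\Delta u=\lambda u$ weakly in $\Omega$. For $g\in L^\infty(\mathbb R^d)$ let $$\lambda_1^g(\Omega)=\min\left\{\frac{\int_\Omega|\nabla u|^2\,dx}{\int_\Omega u^2\,dx}\ :\ u\in H^1_0(\Omega),\ u\not\equiv 0,\ \int_\Omega u\,g\,dx=0\right\}$$ be the first twisted eigenvalue of $\Omega$. If $g\in L^\infty(\mathbb R^d)$ satisfies $0<g(x)\le 1$ for a.e. $x\in\mathbb R^d$, then both $\lambda_1(\Omega)$ and $\lambda_1^g(\Omega)$ are well defined (the smallest eigenvalue exists and the minimum is attained), and $$\lambda_1^g(\Omega)>\lambda_1(\Omega).$$ -/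

import Mathlib

open MeasureTheory Filter Topology TopologicalSpace
open scoped Distributions Gradient

/-- `G` is the weak (distributional) gradient of `u` on the open set `Ω`: both are locally
integrable on `Ω` and `∫_Ω u ∇φ = - ∫_Ω φ G` for every `φ ∈ C_c^∞(Ω)`. -/
structure IsWeakGradient {d : ℕ} (Ω : Opens (EuclideanSpace ℝ (Fin d)))
    (u : EuclideanSpace ℝ (Fin d) → ℝ)
    (G : EuclideanSpace ℝ (Fin d) → EuclideanSpace ℝ (Fin d)) : Prop where
  locallyIntegrableOn : LocallyIntegrableOn u (Ω : Set (EuclideanSpace ℝ (Fin d))) volume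
  locallyIntegrableOn_grad : LocallyIntegrableOn G (Ω : Set (EuclideanSpace ℝ (Fin d))) volume
  integral_eq : ∀ φ : 𝓓(Ω, ℝ), ∫ x in Ω, u x • ∇ φ x = - ∫ x in Ω, φ x • G x

/-- `u` belongs to the Sobolev space `H¹(Ω)`, with weak gradient `G` (which is unique up to
a null subset of `Ω`). -/
structure IsH1 {d : ℕ} (Ω : Opens (EuclideanSpace ℝ (Fin d)))
    (u : EuclideanSpace ℝ (Fin d) → ℝ)
    (G : EuclideanSpace ℝ (Fin d) → EuclideanSpace ℝ (Fin d)) : Prop where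
  memLp : MemLp u 2 (volume.restrict Ω)
  memLp_grad : MemLp G 2 (volume.restrict Ω)
  isWeakGradient : IsWeakGradient Ω u G

/-- `u` belongs to `H¹₀(Ω)`, the closure of `C_c^∞(Ω)` in `H¹(Ω)`, with weak gradient `G`. -/
structure IsH10 {d : ℕ} (Ω : Opens (EuclideanSpace ℝ (Fin d)))
    (u : EuclideanSpace ℝ (Fin d) → ℝ)
    (G : EuclideanSpace ℝ (Fin d) → EuclideanSpace ℝ (Fin d)) : Prop where
  isH1 : IsH1 Ω u G
  exists_approx : ∃ φ : ℕ → 𝓓(Ω, ℝ),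
    Tendsto (fun n => eLpNorm (fun x => φ n x - u x) 2 (volume.restrict Ω)) atTop (𝓝 0) ∧
    Tendsto (fun n => eLpNorm (fun x => ∇ (φ n) x - G x) 2 (volume.restrict Ω)) atTop (𝓝 0)

/-- The values of the Rayleigh quotient `∫_Ω |∇u|² / ∫_Ω u²` at the nonzero elements `u` of the
space of twisted functions `H¹_{0,g}(Ω) = {u ∈ H¹₀(Ω) : ∫_Ω u g = 0}`. -/
def twistedRayleighValues {d : ℕ} (Ω : Opens (EuclideanSpace ℝ (Fin d)))
    (g : EuclideanSpace ℝ (Fin d) → ℝ) : Set ℝ :=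
  {r | ∃ u G, IsH10 Ω u G ∧ ∫ x in Ω, u x * g x = 0 ∧ ¬ u =ᵐ[volume.restrict Ω] 0 ∧
    r = (∫ x in Ω, ‖G x‖ ^ 2) / ∫ x in Ω, u x ^ 2}

/-- The first twisted eigenvalue `λ₁^g(Ω)`. -/
noncomputable def twistedEigenvalue {d : ℕ} (Ω : Opens (EuclideanSpace ℝ (Fin d)))
    (g : EuclideanSpace ℝ (Fin d) → ℝ) : ℝ :=
  sInf (twistedRayleighValues Ω g)

/-- `μ` is an eigenvalue of the Dirichlet Laplacian on `Ω`: there is a nonzero `u ∈ H¹₀(Ω)` with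
`-Δu = μ u` weakly in `Ω`. -/
def IsDirichletEigenvalue {d : ℕ} (Ω : Opens (EuclideanSpace ℝ (Fin d))) (μ : ℝ) : Prop :=
  ∃ u G, IsH10 Ω u G ∧ ¬ u =ᵐ[volume.restrict Ω] 0 ∧
    ∀ φ : 𝓓(Ω, ℝ), ∫ x in Ω, inner ℝ (G x) (∇ φ x) = μ * ∫ x in Ω, u x * φ x

/-- The first (smallest) Dirichlet eigenvalue `λ₁(Ω)`. -/
noncomputable def dirichletEigenvalue {d : ℕ} (Ω : Opens (EuclideanSpace ℝ (Fin d))) : ℝ :=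
  sInf {μ | IsDirichletEigenvalue Ω μ}

/-- The class `L^∞_+` of `g ∈ L^∞(ℝ^d)` with `0 < g ≤ 1` almost everywhere. -/
def IsLInftyPlus {d : ℕ} (g : EuclideanSpace ℝ (Fin d) → ℝ) : Prop :=
  MemLp g ⊤ volume ∧ ∀ᵐ x, 0 < g x ∧ g x ≤ 1

/-! Both numbers are minima of the Rayleigh quotient: the first eigenvalue over H¹₀(Ω), the twisted
one over the subspace ∫ u g = 0. Hence the inequality ≤. If equality held, a twisted minimizer would
minimize over all of H¹₀(Ω). Such a minimizer has a strict sign a.e. in Ω, so its integral against g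
> 0 cannot vanish, a contradiction (`inner_ne_zero_of_rayleigh_minimizer`).

Existence is the direct method. H¹₀(Ω) is modelled as a closed subspace `sobolevZero` of L² × L²,
functions paired with their gradients. Minimizing sequences have L²-convergent subsequences by
Rellich's theorem, proved by approximating the embedding into L² by finite-rank averages over small
cubes; the parallelogram law then gives convergence of the gradients too
(`exists_mem_of_tendsto_minimizing`). The Euler-Lagrange equation identifies the minimum with the
least eigenvalue.

For the sign, the positive part of a minimizer is again a minimizer
(`exists_mem_sobolevZero_posPart`), hence a nonnegative weak solution of -Δu = λu with λ ≥ 0, hence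
superharmonic. The strong maximum principle (`ae_eq_zero_or_pos_of_superharmonic`) needs no
regularity of u: smooth radial averages of a superharmonic function increase as the radius shrinks,
and they tend to 0 at a Lebesgue point where u = 0, so u vanishes on balls around that point;
connectedness propagates this to Ω. -/

/-! ### Minimizing a Rayleigh quotient in an abstract product space -/

section QuadraticForms

variable {X Y : Type*} [NormedAddCommGroup X] [InnerProductSpace ℝ X]
  [NormedAddCommGroup Y] [InnerProductSpace ℝ Y]

/-- Strong convergence of minimizing sequences: if `c ‖x‖² ≤ ‖y‖²` on a closed subspace `V` and
`(xₙ, yₙ)` in `V` satisfies `xₙ → a`, `‖yₙ‖² → c ‖a‖²`, then `yₙ` converges as well, to a `b` with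
`(a, b) ∈ V`. -/
theorem exists_mem_of_tendsto_minimizing [CompleteSpace Y] {V : Submodule ℝ (X × Y)}
    (hV : IsClosed (V : Set (X × Y))) {c : ℝ} (hc : ∀ p ∈ V, c * ‖p.1‖ ^ 2 ≤ ‖p.2‖ ^ 2)
    {p : ℕ → X × Y} (hp : ∀ n, p n ∈ V) {a : X}
    (ha : Tendsto (fun n => (p n).1) atTop (𝓝 a))
    (hb : Tendsto (fun n => ‖(p n).2‖ ^ 2) atTop (𝓝 (c * ‖a‖ ^ 2))) :
    ∃ b, (a, b) ∈ V ∧ ‖b‖ ^ 2 = c * ‖a‖ ^ 2 := by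
  have hcau : CauchySeq fun n => (p n).2 := by
    rw [Metric.cauchySeq_iff']
    -- By the parallelogram law and `hc` applied to the sum of two terms, this expression bounds the
    -- squared distance of the second components. Its limit is 2c‖a‖² + 2c‖a‖² - 4c‖a‖² = 0.
    have key : Tendsto (fun q : ℕ × ℕ => 2 * ‖(p q.1).2‖ ^ 2 + 2 * ‖(p q.2).2‖ ^ 2
        - c * ‖(p q.1).1 + (p q.2).1‖ ^ 2) (atTop ×ˢ atTop) (𝓝 0) := by
      have h1 := hb.comp (tendsto_fst (f := (atTop : Filter ℕ)) (g := (atTop : Filter ℕ)))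
      have h2 := hb.comp (tendsto_snd (f := (atTop : Filter ℕ)) (g := (atTop : Filter ℕ)))
      have h3 := ha.comp (tendsto_fst (f := (atTop : Filter ℕ)) (g := (atTop : Filter ℕ)))
      have h4 := ha.comp (tendsto_snd (f := (atTop : Filter ℕ)) (g := (atTop : Filter ℕ)))
      have h5 := ((h1.const_mul 2).add (h2.const_mul 2)).sub
        ((((h3.add h4).norm).pow 2).const_mul c)
      have h6 : 2 * (c * ‖a‖ ^ 2) + 2 * (c * ‖a‖ ^ 2) - c * ‖a + a‖ ^ 2 = 0 := by
        rw [← two_smul ℝ a, norm_smul]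
        norm_num
        ring
      rw [h6] at h5
      exact h5
    intro ε hε
    have h7 := key.eventually (gt_mem_nhds (show (0 : ℝ) < ε ^ 2 by positivity))
    rw [prod_atTop_atTop_eq, eventually_atTop] at h7
    obtain ⟨⟨N, M⟩, hN⟩ := h7
    refine ⟨max N M, fun n hn => ?_⟩
    have h8 := hN (n, max N M) ⟨le_trans (le_max_left _ _) hn, le_max_right _ _⟩
    have h9 := hc _ (V.add_mem (hp n) (hp (max N M)))
    have h10 := parallelogram_law_with_norm ℝ (p n).2 (p (max N M)).2
    simp only [Prod.fst_add, Prod.snd_add] at h9 h8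
    rw [dist_eq_norm]
    refine lt_of_pow_lt_pow_left₀ 2 hε.le ?_
    nlinarith
  obtain ⟨b, hb'⟩ := cauchySeq_tendsto_of_complete hcau
  refine ⟨b, ?_, tendsto_nhds_unique (hb'.norm.pow 2) hb⟩
  exact hV.mem_of_tendsto (ha.prodMk_nhds hb') (Eventually.of_forall hp)

/-- The Rayleigh quotient attains its infimum on a closed subspace whose first projection is
compact. -/
theorem exists_rayleigh_minimizer [CompleteSpace Y] {V : Submodule ℝ (X × Y)}
    (hV : IsClosed (V : Set (X × Y)))
    (hcpt : ∀ p : ℕ → X × Y, (∀ n, p n ∈ V) → (∃ C, ∀ n, ‖p n‖ ≤ C) →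
      ∃ a, ∃ σ : ℕ → ℕ, StrictMono σ ∧ Tendsto (fun n => (p (σ n)).1) atTop (𝓝 a))
    (hne : ∃ p ∈ V, p.1 ≠ 0) :
    ∃ c : ℝ, (∀ p ∈ V, c * ‖p.1‖ ^ 2 ≤ ‖p.2‖ ^ 2) ∧
      ∃ p ∈ V, p.1 ≠ 0 ∧ ‖p.2‖ ^ 2 = c * ‖p.1‖ ^ 2 := by
  set S : Set ℝ := {r | ∃ p ∈ V, ‖p.1‖ = 1 ∧ r = ‖p.2‖ ^ 2} with hS
  have hnorm : ∀ p ∈ V, p.1 ≠ 0 → ‖p.2‖ ^ 2 / ‖p.1‖ ^ 2 ∈ S := by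
    intro p hp h0
    refine ⟨‖p.1‖⁻¹ • p, V.smul_mem _ hp, ?_, ?_⟩
    · simp [norm_smul, h0]
    · simp [norm_smul, mul_pow]
      field_simp
  have hSne : S.Nonempty := by
    obtain ⟨p, hp, h0⟩ := hne
    exact ⟨_, hnorm p hp h0⟩
  have hSbdd : BddBelow S := ⟨0, by rintro _ ⟨p, -, -, rfl⟩; positivity⟩
  have hc : ∀ p ∈ V, sInf S * ‖p.1‖ ^ 2 ≤ ‖p.2‖ ^ 2 := by
    intro p hp
    by_cases h0 : p.1 = 0
    · simp [h0]
    · have := csInf_le hSbdd (hnorm p hp h0)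
      rwa [le_div_iff₀ (by positivity)] at this
  refine ⟨sInf S, hc, ?_⟩
  obtain ⟨r, -, hr, hrS⟩ := exists_seq_tendsto_sInf hSne hSbdd
  choose p hpV hp1 hp2 using hrS
  obtain ⟨C, hC⟩ := hr.bddAbove_range
  obtain ⟨a, σ, hσ, ha⟩ := hcpt p hpV ⟨max 1 (C + 1), fun n => by
    rw [Prod.norm_def, hp1]
    refine max_le_max le_rfl ?_
    have : r n ≤ C := hC ⟨n, rfl⟩
    rw [hp2] at this
    -- From ‖y‖² ≤ C, expanding (‖y‖ - 1)² ≥ 0 gives 2‖y‖ ≤ C + 1.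
    nlinarith [sq_nonneg (‖(p n).2‖ - 1)]⟩
  have ha1 : ‖a‖ = 1 := by
    refine tendsto_nhds_unique ha.norm ?_
    simp [hp1]
  obtain ⟨b, hb, hb2⟩ := exists_mem_of_tendsto_minimizing hV hc (fun n => hpV (σ n)) ha (by
    simp only [← hp2, ha1, one_pow, mul_one]
    exact hr.comp hσ.tendsto_atTop)
  refine ⟨(a, b), hb, ?_, hb2⟩
  intro h
  simp only at h
  simp [h] at ha1

/-- The Euler-Lagrange equation of a minimizer of the Rayleigh quotient. -/
theorem inner_eq_of_rayleigh_minimizer {V : Submodule ℝ (X × Y)} {c : ℝ}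
    (hc : ∀ p ∈ V, c * ‖p.1‖ ^ 2 ≤ ‖p.2‖ ^ 2) {p : X × Y} (hp : p ∈ V)
    (hmin : ‖p.2‖ ^ 2 = c * ‖p.1‖ ^ 2) {q : X × Y} (hq : q ∈ V) :
    inner ℝ p.2 q.2 = c * inner ℝ p.1 q.1 := by
  set A := inner ℝ p.2 q.2 - c * inner ℝ p.1 q.1 with hA
  set B := ‖q.2‖ ^ 2 - c * ‖q.1‖ ^ 2 with hB
  -- This is ‖y‖² - c‖x‖² evaluated along `p + t • q`; the constant term vanishes because `p` is a
  -- minimizer, so the discriminant 4A² is at most 0.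
  have key : ∀ t : ℝ, 0 ≤ B * (t * t) + 2 * A * t + 0 := by
    intro t
    have h := hc _ (V.add_mem hp (V.smul_mem t hq))
    simp only [Prod.fst_add, Prod.snd_add, Prod.smul_fst, Prod.smul_snd] at h
    rw [norm_add_sq_real, norm_add_sq_real, inner_smul_right, inner_smul_right, norm_smul,
      norm_smul, mul_pow, mul_pow, Real.norm_eq_abs, sq_abs] at h
    simp only [hA, hB]
    linarith
  have h := discrim_le_zero key
  rw [discrim] at h
  have hA0 : A = 0 := by nlinarith [sq_nonneg A]
  linarith

end QuadraticForms

/-! ### H¹₀(Ω) as a closed subspace of L² × L² -/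

section SobolevZero

variable {d : ℕ} {Ω : Opens (EuclideanSpace ℝ (Fin d))}

theorem inner_gradient_eq_fderiv {E : Type*} [NormedAddCommGroup E] [InnerProductSpace ℝ E]
    [CompleteSpace E] (f : E → ℝ) (x v : E) : inner ℝ (∇ f x) v = fderiv ℝ f x v :=
  inner_gradient_left

namespace TestFunction

theorem differentiable (φ : 𝓓(Ω, ℝ)) : Differentiable ℝ φ :=
  φ.contDiff.differentiable (by simp)

theorem continuous_gradient (φ : 𝓓(Ω, ℝ)) : Continuous (∇ φ) :=
  (InnerProductSpace.toDual ℝ _).symm.continuous.comp (φ.contDiff.continuous_fderiv (by simp))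

theorem hasCompactSupport_gradient (φ : 𝓓(Ω, ℝ)) : HasCompactSupport (∇ φ) :=
  (φ.hasCompactSupport.fderiv ℝ).comp_left (g := (InnerProductSpace.toDual ℝ _).symm) (map_zero _)

theorem memLp (φ : 𝓓(Ω, ℝ)) : MemLp φ 2 (volume.restrict Ω) :=
  (φ.continuous.memLp_of_hasCompactSupport φ.hasCompactSupport).restrict _

theorem memLp_gradient (φ : 𝓓(Ω, ℝ)) : MemLp (∇ φ) 2 (volume.restrict Ω) :=
  (φ.continuous_gradient.memLp_of_hasCompactSupport φ.hasCompactSupport_gradient).restrict _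

theorem gradient_add (φ ψ : 𝓓(Ω, ℝ)) : ∇ (φ + ψ : 𝓓(Ω, ℝ)) = ∇ φ + ∇ ψ := by
  ext1 x
  simp only [gradient, Pi.add_apply, ← map_add]
  congr 1
  exact fderiv_add (φ.differentiable x) (ψ.differentiable x)

theorem gradient_smul (c : ℝ) (φ : 𝓓(Ω, ℝ)) : ∇ (c • φ : 𝓓(Ω, ℝ)) = c • ∇ φ := by
  ext1 x
  simp only [gradient, Pi.smul_apply, ← map_smul]
  congr 1
  exact fderiv_const_smul (φ.differentiable x) c

theorem eq_zero_of_notMem (φ : 𝓓(Ω, ℝ)) {x : EuclideanSpace ℝ (Fin d)} (hx : x ∉ Ω) : φ x = 0 :=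
  image_eq_zero_of_notMem_tsupport fun h => hx (φ.tsupport_subset h)

theorem gradient_eq_zero_of_notMem (φ : 𝓓(Ω, ℝ)) {x : EuclideanSpace ℝ (Fin d)} (hx : x ∉ Ω) :
    ∇ φ x = 0 := by
  have : fderiv ℝ φ x = 0 := by
    exact image_eq_zero_of_notMem_tsupport fun h =>
      hx (φ.tsupport_subset (tsupport_fderiv_subset ℝ h))
  simp [gradient, this]

theorem setIntegral_mul_inner_gradient (φ ψ : 𝓓(Ω, ℝ)) (v : EuclideanSpace ℝ (Fin d)) :
    ∫ x in Ω, φ x * inner ℝ (∇ ψ x) v = - ∫ x in Ω, inner ℝ (∇ φ x) v * ψ x := by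
  rw [setIntegral_eq_integral_of_forall_compl_eq_zero
    (fun x hx => by simp [φ.eq_zero_of_notMem hx]),
    setIntegral_eq_integral_of_forall_compl_eq_zero
    (fun x hx => by simp [ψ.eq_zero_of_notMem hx])]
  have h1 := φ.continuous
  have h2 := ψ.continuous
  have h3 := φ.continuous_gradient
  have h4 := ψ.continuous_gradient
  simp only [inner_gradient_eq_fderiv]
  apply integral_mul_fderiv_eq_neg_fderiv_mul_of_integrable
  · simp only [← inner_gradient_eq_fderiv]
    exact Continuous.integrable_of_hasCompactSupport (by fun_prop)
      ψ.hasCompactSupport.mul_left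
  · simp only [← inner_gradient_eq_fderiv]
    exact Continuous.integrable_of_hasCompactSupport (by fun_prop)
      φ.hasCompactSupport.mul_right
  · exact Continuous.integrable_of_hasCompactSupport (by fun_prop)
      φ.hasCompactSupport.mul_right
  · exact fun x _ => φ.differentiable x
  · exact fun x _ => ψ.differentiable x

end TestFunction

variable (Ω) in
/-- A test function together with its gradient, as an element of `L²(Ω) × L²(Ω; ℝᵈ)`. -/
noncomputable def testPair : 𝓓(Ω, ℝ) →ₗ[ℝ]
    Lp ℝ 2 (volume.restrict (Ω : Set (EuclideanSpace ℝ (Fin d)))) ×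
      Lp (EuclideanSpace ℝ (Fin d)) 2 (volume.restrict (Ω : Set (EuclideanSpace ℝ (Fin d)))) where
  toFun φ := (φ.memLp.toLp φ, φ.memLp_gradient.toLp (∇ φ))
  map_add' φ ψ := by
    refine Prod.ext ?_ ?_
    · exact MemLp.toLp_add φ.memLp ψ.memLp
    · simp only [TestFunction.gradient_add]
      exact MemLp.toLp_add φ.memLp_gradient ψ.memLp_gradient
  map_smul' c φ := by
    refine Prod.ext ?_ ?_
    · exact MemLp.toLp_const_smul c φ.memLp
    · simp only [TestFunction.gradient_smul]
      exact MemLp.toLp_const_smul c φ.memLp_gradient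

theorem testPair_fst_ae (φ : 𝓓(Ω, ℝ)) : (testPair Ω φ).1 =ᵐ[volume.restrict Ω] φ :=
  φ.memLp.coeFn_toLp

theorem testPair_snd_ae (φ : 𝓓(Ω, ℝ)) : (testPair Ω φ).2 =ᵐ[volume.restrict Ω] ∇ φ :=
  φ.memLp_gradient.coeFn_toLp

variable (Ω) in
/-- `H¹₀(Ω)` as a closed subspace of `L²(Ω) × L²(Ω; ℝᵈ)`. -/
noncomputable def sobolevZero : Submodule ℝ
    (Lp ℝ 2 (volume.restrict (Ω : Set (EuclideanSpace ℝ (Fin d)))) ×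
      Lp (EuclideanSpace ℝ (Fin d)) 2 (volume.restrict (Ω : Set (EuclideanSpace ℝ (Fin d))))) :=
  (LinearMap.range (testPair Ω)).topologicalClosure

theorem isClosed_sobolevZero : IsClosed (sobolevZero Ω : Set
    (Lp ℝ 2 (volume.restrict (Ω : Set (EuclideanSpace ℝ (Fin d)))) ×
      Lp (EuclideanSpace ℝ (Fin d)) 2
        (volume.restrict (Ω : Set (EuclideanSpace ℝ (Fin d)))))) :=
  Submodule.isClosed_topologicalClosure _

theorem testPair_mem_sobolevZero (φ : 𝓓(Ω, ℝ)) : testPair Ω φ ∈ sobolevZero Ω :=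
  Submodule.le_topologicalClosure _ ⟨φ, rfl⟩

theorem exists_tendsto_of_mem_sobolevZero {p} (hp : p ∈ sobolevZero Ω) :
    ∃ φ : ℕ → 𝓓(Ω, ℝ), Tendsto (fun n => testPair Ω (φ n)) atTop (𝓝 p) := by
  have hp' : p ∈ closure (LinearMap.range (testPair Ω) : Set (_ × _)) := hp
  obtain ⟨q, hq, hlim⟩ := mem_closure_iff_seq_limit.1 hp'
  choose φ hφ using hq
  exact ⟨φ, by simpa only [hφ] using hlim⟩

/-- Two continuous functions that agree on test functions agree on `H¹₀(Ω)`. -/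
theorem eq_of_mem_sobolevZero {Z : Type*} [TopologicalSpace Z] [T2Space Z]
    {f g : Lp ℝ 2 (volume.restrict (Ω : Set (EuclideanSpace ℝ (Fin d)))) ×
      Lp (EuclideanSpace ℝ (Fin d)) 2 (volume.restrict (Ω : Set (EuclideanSpace ℝ (Fin d)))) → Z}
    (hf : Continuous f) (hg : Continuous g) (h : ∀ φ, f (testPair Ω φ) = g (testPair Ω φ))
    {p} (hp : p ∈ sobolevZero Ω) : f p = g p := by
  obtain ⟨φ, hφ⟩ := exists_tendsto_of_mem_sobolevZero hp
  refine tendsto_nhds_unique ((hf.tendsto p).comp hφ) ?_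
  simpa only [Function.comp_def, h] using (hg.tendsto p).comp hφ

/-- Both sides are L² pairings with fixed functions, hence continuous in `p`, so integration by
parts passes from test functions to their closure. Fixing a direction `v` makes the identity scalar.
-/
theorem integral_mul_inner_gradient_of_mem_sobolevZero {p} (hp : p ∈ sobolevZero Ω) (ψ : 𝓓(Ω, ℝ))
    (v : EuclideanSpace ℝ (Fin d)) :
    ∫ x in Ω, p.1 x * inner ℝ (∇ ψ x) v = - ∫ x in Ω, inner ℝ (p.2 x) v * ψ x := by
  have hψ1 : MemLp (fun x => inner ℝ (∇ ψ x) v) 2 (volume.restrict Ω) :=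
    ψ.memLp_gradient.inner_const v
  have hψ2 : MemLp (fun x => ψ x • v) 2 (volume.restrict Ω) := by
    have := ψ.continuous
    exact (Continuous.memLp_of_hasCompactSupport (by fun_prop)
      ψ.hasCompactSupport.smul_right).restrict _
  have e1 : ∀ u : Lp ℝ 2 (volume.restrict (Ω : Set (EuclideanSpace ℝ (Fin d)))),
      ∫ x in Ω, u x * inner ℝ (∇ ψ x) v = inner ℝ (hψ1.toLp _) u := by
    intro u
    rw [L2.inner_def]
    refine integral_congr_ae ?_
    filter_upwards [hψ1.coeFn_toLp] with x hx
    rw [hx, RCLike.inner_apply, conj_trivial]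
  have e2 : ∀ G : Lp (EuclideanSpace ℝ (Fin d)) 2
      (volume.restrict (Ω : Set (EuclideanSpace ℝ (Fin d)))),
      ∫ x in Ω, inner ℝ (G x) v * ψ x = inner ℝ (hψ2.toLp _) G := by
    intro G
    rw [L2.inner_def]
    refine integral_congr_ae ?_
    filter_upwards [hψ2.coeFn_toLp] with x hx
    simp only [hx]
    rw [real_inner_smul_left, real_inner_comm, mul_comm]
  rw [e1, e2]
  refine eq_of_mem_sobolevZero (f := fun p => inner ℝ (hψ1.toLp _) p.1)
    (g := fun p => - inner ℝ (hψ2.toLp _) p.2) (by fun_prop) (by fun_prop) ?_ hp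
  intro φ
  rw [← e1, ← e2]
  have h := φ.setIntegral_mul_inner_gradient ψ v
  rw [integral_congr_ae (g := fun x => φ x * inner ℝ (∇ ψ x) v),
    integral_congr_ae (f := fun x => inner ℝ ((testPair Ω φ).2 x) v * ψ x)
      (g := fun x => inner ℝ (∇ φ x) v * ψ x)]
  · exact h
  · filter_upwards [testPair_snd_ae φ] with x hx
    rw [hx]
  · filter_upwards [testPair_fst_ae φ] with x hx
    rw [hx]

theorem isFiniteMeasure_restrict_of_isBounded
    (hΩ : Bornology.IsBounded (Ω : Set (EuclideanSpace ℝ (Fin d)))) :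
    IsFiniteMeasure (volume.restrict (Ω : Set (EuclideanSpace ℝ (Fin d)))) :=
  ⟨by simpa using hΩ.measure_lt_top⟩

/-- With the converse below, this allows closedness and density arguments in L² × L² to replace the
pointwise predicates. Finiteness of the measure gives L² ⊆ L¹, hence local integrability. -/
theorem isH10_of_mem_sobolevZero
    [IsFiniteMeasure (volume.restrict (Ω : Set (EuclideanSpace ℝ (Fin d))))]
    {p} (hp : p ∈ sobolevZero Ω) : IsH10 Ω p.1 p.2 where
  isH1 :=
    { memLp := Lp.memLp _
      memLp_grad := Lp.memLp _
      isWeakGradient :=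
        { locallyIntegrableOn :=
            IntegrableOn.locallyIntegrableOn ((Lp.memLp p.1).integrable (by norm_num))
          locallyIntegrableOn_grad :=
            IntegrableOn.locallyIntegrableOn ((Lp.memLp p.2).integrable (by norm_num))
          integral_eq := fun φ => by
            refine ext_inner_right ℝ fun v => ?_
            have i1 : Integrable (fun x => p.1 x • ∇ φ x) (volume.restrict Ω) :=
              memLp_one_iff_integrable.1 (φ.memLp_gradient.smul (Lp.memLp p.1))
            have i2 : Integrable (fun x => φ x • p.2 x) (volume.restrict Ω) :=
              memLp_one_iff_integrable.1 ((Lp.memLp p.2).smul φ.memLp)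
            rw [inner_neg_left, real_inner_comm, real_inner_comm v, ← integral_inner i1,
              ← integral_inner i2]
            have h := integral_mul_inner_gradient_of_mem_sobolevZero hp φ v
            simp only [inner_smul_right]
            simp only [real_inner_comm _ v, mul_comm (φ _)]
            exact h } }
  exists_approx := by
    obtain ⟨φ, hφ⟩ := exists_tendsto_of_mem_sobolevZero hp
    have h1 := (continuous_fst.tendsto p).comp hφ
    have h2 := (continuous_snd.tendsto p).comp hφ
    rw [Lp.tendsto_Lp_iff_tendsto_eLpNorm'] at h1 h2
    refine ⟨φ, h1.congr fun n => eLpNorm_congr_ae ?_, h2.congr fun n => eLpNorm_congr_ae ?_⟩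
    · filter_upwards [testPair_fst_ae (φ n)] with x hx
      simp [hx]
    · filter_upwards [testPair_snd_ae (φ n)] with x hx
      simp [hx]

theorem IsH10.exists_mem_sobolevZero {u : EuclideanSpace ℝ (Fin d) → ℝ}
    {G : EuclideanSpace ℝ (Fin d) → EuclideanSpace ℝ (Fin d)} (h : IsH10 Ω u G) :
    ∃ p ∈ sobolevZero Ω, p.1 =ᵐ[volume.restrict Ω] u ∧ p.2 =ᵐ[volume.restrict Ω] G := by
  obtain ⟨φ, h1, h2⟩ := h.exists_approx
  refine ⟨(h.isH1.memLp.toLp u, h.isH1.memLp_grad.toLp G), ?_, h.isH1.memLp.coeFn_toLp,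
    h.isH1.memLp_grad.coeFn_toLp⟩
  refine isClosed_sobolevZero.mem_of_tendsto (b := atTop) (f := fun n => testPair Ω (φ n)) ?_
    (Eventually.of_forall fun n => testPair_mem_sobolevZero (φ n))
  refine Tendsto.prodMk_nhds ?_ ?_
  · exact (Lp.tendsto_Lp_iff_tendsto_eLpNorm'' _ (fun n => (φ n).memLp) u h.isH1.memLp).2 h1
  · exact (Lp.tendsto_Lp_iff_tendsto_eLpNorm'' _ (fun n => (φ n).memLp_gradient) G
      h.isH1.memLp_grad).2 h2

theorem MeasureTheory.Lp.norm_sq_eq_integral {α E : Type*} [MeasurableSpace α] {μ : Measure α}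
    [NormedAddCommGroup E] [InnerProductSpace ℝ E] (f : Lp E 2 μ) :
    ‖f‖ ^ 2 = ∫ x, ‖f x‖ ^ 2 ∂μ := by
  rw [← real_inner_self_eq_norm_sq, L2.inner_def]
  simp

theorem mem_twistedRayleighValues_iff
    [IsFiniteMeasure (volume.restrict (Ω : Set (EuclideanSpace ℝ (Fin d))))]
    {g : EuclideanSpace ℝ (Fin d) → ℝ} (hg : MemLp g 2 (volume.restrict Ω)) {r : ℝ} :
    r ∈ twistedRayleighValues Ω g ↔
      ∃ p ∈ sobolevZero Ω, inner ℝ (hg.toLp g) p.1 = 0 ∧ p.1 ≠ 0 ∧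
        r = ‖p.2‖ ^ 2 / ‖p.1‖ ^ 2 := by
  have hin : ∀ u : Lp ℝ 2 (volume.restrict (Ω : Set (EuclideanSpace ℝ (Fin d)))),
      inner ℝ (hg.toLp g) u = ∫ x in Ω, u x * g x := fun u => by
    rw [L2.inner_def]
    refine integral_congr_ae ?_
    filter_upwards [hg.coeFn_toLp] with x hx
    simp [hx]
  constructor
  · rintro ⟨u, G, huG, h0, hne, rfl⟩
    obtain ⟨p, hp, hu, hG⟩ := huG.exists_mem_sobolevZero
    refine ⟨p, hp, ?_, ?_, ?_⟩
    · rw [hin, ← h0]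
      refine integral_congr_ae ?_
      filter_upwards [hu] with x hx
      rw [hx]
    · intro h
      rw [Lp.eq_zero_iff_ae_eq_zero] at h
      exact hne (hu.symm.trans h)
    · rw [Lp.norm_sq_eq_integral, Lp.norm_sq_eq_integral]
      congr 1
      · refine integral_congr_ae ?_
        filter_upwards [hG] with x hx
        rw [hx]
      · refine integral_congr_ae ?_
        filter_upwards [hu] with x hx
        simp [hx]
  · rintro ⟨p, hp, h0, hne, rfl⟩
    refine ⟨p.1, p.2, isH10_of_mem_sobolevZero hp, ?_, ?_, ?_⟩
    · rw [← hin, h0]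
    · rwa [← Lp.eq_zero_iff_ae_eq_zero]
    · rw [Lp.norm_sq_eq_integral, Lp.norm_sq_eq_integral]
      simp

/-- Both sides of the weak equation are continuous in the second argument, so testing against C_c^∞
functions is equivalent to testing against all of H¹₀(Ω). -/
theorem isDirichletEigenvalue_iff
    [IsFiniteMeasure (volume.restrict (Ω : Set (EuclideanSpace ℝ (Fin d))))] {c : ℝ} :
    IsDirichletEigenvalue Ω c ↔ ∃ p ∈ sobolevZero Ω, p.1 ≠ 0 ∧
      ∀ q ∈ sobolevZero Ω, inner ℝ p.2 q.2 = c * inner ℝ p.1 q.1 := by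
  constructor
  · rintro ⟨u, G, huG, hne, hev⟩
    obtain ⟨p, hp, hu, hG⟩ := huG.exists_mem_sobolevZero
    refine ⟨p, hp, ?_, fun q hq => ?_⟩
    · intro h
      rw [Lp.eq_zero_iff_ae_eq_zero] at h
      exact hne (hu.symm.trans h)
    · refine eq_of_mem_sobolevZero (f := fun q => inner ℝ p.2 q.2)
        (g := fun q => c * inner ℝ p.1 q.1) (by fun_prop) (by fun_prop) (fun φ => ?_) hq
      simp only [L2.inner_def]
      have h := hev φ
      rw [integral_congr_ae (g := fun x => inner ℝ (G x) (∇ φ x)),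
        integral_congr_ae (f := fun x => inner ℝ (p.1 x) ((testPair Ω φ).1 x))
          (g := fun x => u x * φ x)]
      · exact h
      · filter_upwards [testPair_fst_ae φ, hu] with x hx hx'
        simp [hx, hx', mul_comm]
      · filter_upwards [testPair_snd_ae φ, hG] with x hx hx'
        rw [hx, hx']
  · rintro ⟨p, hp, hne, hev⟩
    refine ⟨p.1, p.2, isH10_of_mem_sobolevZero hp, ?_, fun φ => ?_⟩
    · rwa [← Lp.eq_zero_iff_ae_eq_zero]
    · have h := hev _ (testPair_mem_sobolevZero φ)
      simp only [L2.inner_def] at h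
      rw [integral_congr_ae (g := fun x => inner ℝ (p.2 x) (∇ φ x)),
        integral_congr_ae (f := fun x => inner ℝ (p.1 x) ((testPair Ω φ).1 x))
          (g := fun x => p.1 x * φ x)] at h
      · exact h
      · filter_upwards [testPair_fst_ae φ] with x hx
        simp [hx, mul_comm]
      · filter_upwards [testPair_snd_ae φ] with x hx
        rw [hx]

end SobolevZero

/-! ### Poincaré inequality on a grid of cubes -/

section Rellich

open scoped ENNReal

/-- Jensen's inequality for the square: on a probability space the L¹ norm is at most the L² norm.
-/
theorem enorm_integral_sq_le {α : Type*} [MeasurableSpace α] {ν : Measure α}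
    [IsProbabilityMeasure ν] {f : α → ℝ} (hf : AEStronglyMeasurable f ν) :
    ‖∫ x, f x ∂ν‖ₑ ^ 2 ≤ ∫⁻ x, ‖f x‖ₑ ^ 2 ∂ν := by
  have h1 : ‖∫ x, f x ∂ν‖ₑ ≤ eLpNorm f 2 ν := by
    refine (enorm_integral_le_lintegral_enorm f).trans ?_
    rw [← eLpNorm_one_eq_lintegral_enorm]
    exact eLpNorm_le_eLpNorm_of_exponent_le (by norm_num) hf
  have h2 := eLpNorm_nnreal_pow_eq_lintegral (μ := ν) (f := f) (p := 2) (by norm_num)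
  simp only [NNReal.coe_ofNat, ENNReal.rpow_ofNat, ENNReal.coe_ofNat] at h2
  rw [← h2]
  gcongr

theorem MeasureTheory.Lp.enorm_sq_eq_lintegral {α E : Type*} [MeasurableSpace α] {μ : Measure α}
    [NormedAddCommGroup E] (f : Lp E 2 μ) : ‖f‖ₑ ^ 2 = ∫⁻ x, ‖f x‖ₑ ^ 2 ∂μ := by
  have h2 := eLpNorm_nnreal_pow_eq_lintegral (μ := μ) (f := f) (p := 2) (by norm_num)
  simp only [NNReal.coe_ofNat, ENNReal.rpow_ofNat, ENNReal.coe_ofNat] at h2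
  rw [Lp.enorm_def, h2]

/-- A function is close to its average on `A` when its oscillation on `A × A` is small. -/
theorem lintegral_enorm_sub_average_sq_le {α : Type*} [MeasurableSpace α] {μ : Measure α}
    {A : Set α} (hA0 : μ A ≠ 0) (hA : μ A ≠ ∞) {f : α → ℝ} (hf : IntegrableOn f A μ) :
    ∫⁻ x in A, ‖f x - ⨍ y in A, f y ∂μ‖ₑ ^ 2 ∂μ ≤
      (μ A)⁻¹ * ∫⁻ x in A, ∫⁻ y in A, ‖f x - f y‖ₑ ^ 2 ∂μ ∂μ := by
  rw [← lintegral_const_mul' _ _ (by simpa using hA0)]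
  refine lintegral_mono fun x => ?_
  have : IsProbabilityMeasure ((μ A)⁻¹ • μ.restrict A) :=
    ⟨by simp [ENNReal.inv_mul_cancel hA0 hA]⟩
  have hint : Integrable f ((μ A)⁻¹ • μ.restrict A) := hf.smul_measure (by simpa using hA0)
  have h1 : f x - ⨍ y in A, f y ∂μ = ∫ y, (f x - f y) ∂((μ A)⁻¹ • μ.restrict A) := by
    rw [integral_sub (integrable_const _) hint, average]
    simp
  have h2 := enorm_integral_sq_le (ν := (μ A)⁻¹ • μ.restrict A) (f := fun y => f x - f y)
    ((integrable_const _).sub hint).aestronglyMeasurable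
  simp only [h1]
  rwa [lintegral_smul_measure, smul_eq_mul] at h2

variable {d : ℕ} {Ω : Opens (EuclideanSpace ℝ (Fin d))}

/-- The increment is the integral of the derivative along the segment from x to x + h; Jensen and
Cauchy-Schwarz give the bound. -/
theorem TestFunction.enorm_translate_sub_sq_le (φ : 𝓓(Ω, ℝ)) (x h : EuclideanSpace ℝ (Fin d)) :
    ‖φ x - φ (x + h)‖ₑ ^ 2 ≤ ‖h‖ₑ ^ 2 * ∫⁻ t in Set.Ioc (0 : ℝ) 1, ‖∇ φ (x + t • h)‖ₑ ^ 2 := by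
  have hc := φ.continuous_gradient
  have hder : ∀ t : ℝ, HasDerivAt (fun t : ℝ => φ (x + t • h)) (inner ℝ (∇ φ (x + t • h)) h) t := by
    intro t
    rw [inner_gradient_eq_fderiv]
    have h1 : HasDerivAt (fun t : ℝ => x + t • h) h t := by
      simpa using ((hasDerivAt_id t).smul_const h).const_add x
    exact ((φ.differentiable (x + t • h)).hasFDerivAt).comp_hasDerivAt t h1
  have hftc := intervalIntegral.integral_eq_sub_of_hasDerivAt (a := 0) (b := 1)
    (fun t _ => hder t) (Continuous.intervalIntegrable (by fun_prop) _ _)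
  rw [intervalIntegral.integral_of_le zero_le_one] at hftc
  simp only [one_smul, zero_smul, add_zero] at hftc
  have : IsProbabilityMeasure ((volume : Measure ℝ).restrict (Set.Ioc (0 : ℝ) 1)) := ⟨by simp⟩
  rw [← neg_sub, enorm_neg, ← hftc]
  refine (enorm_integral_sq_le (Continuous.aestronglyMeasurable (by fun_prop))).trans ?_
  rw [← lintegral_const_mul' _ _ (by simp)]
  refine lintegral_mono fun t => ?_
  rw [← mul_pow, mul_comm]
  gcongr
  simp only [← ofReal_norm]
  rw [← ENNReal.ofReal_mul (norm_nonneg _)]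
  exact ENNReal.ofReal_le_ofReal (norm_inner_le_norm _ _)

/-- Integrate the pointwise bound, exchange the integrals, and use translation invariance for each
t. -/
theorem TestFunction.lintegral_enorm_translate_sub_sq_le (φ : 𝓓(Ω, ℝ))
    (h : EuclideanSpace ℝ (Fin d)) :
    ∫⁻ x, ‖φ x - φ (x + h)‖ₑ ^ 2 ≤ ‖h‖ₑ ^ 2 * ∫⁻ x, ‖∇ φ x‖ₑ ^ 2 := by
  have hc := φ.continuous_gradient
  refine (lintegral_mono fun x => φ.enorm_translate_sub_sq_le x h).trans ?_
  rw [lintegral_const_mul' _ _ (by simp), lintegral_lintegral_swap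
    (Continuous.measurable (by fun_prop)).aemeasurable]
  have : ∀ t : ℝ, ∫⁻ x, ‖∇ φ (x + t • h)‖ₑ ^ 2 = ∫⁻ x, ‖∇ φ x‖ₑ ^ 2 := fun t =>
    lintegral_add_right_eq_self (fun x => ‖∇ φ x‖ₑ ^ 2) (t • h)
  simp [this]

/-- The half-open cube of side `ε` with lowest corner `ε k`. -/
def gridCube (ε : ℝ) (k : Fin d → ℤ) : Set (EuclideanSpace ℝ (Fin d)) :=
  {x | ∀ i, ⌊x i / ε⌋ = k i}

theorem gridCube_eq_preimage {ε : ℝ} (hε : 0 < ε) (k : Fin d → ℤ) :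
    gridCube ε k = (WithLp.ofLp : EuclideanSpace ℝ (Fin d) → Fin d → ℝ) ⁻¹'
      Set.univ.pi fun i => Set.Ico (k i * ε) ((k i + 1) * ε) := by
  ext x
  simp [gridCube, Int.floor_eq_iff, le_div_iff₀ hε, div_lt_iff₀ hε]

theorem measurableSet_gridCube {ε : ℝ} (hε : 0 < ε) (k : Fin d → ℤ) :
    MeasurableSet (gridCube ε k) := by
  rw [gridCube_eq_preimage hε]
  exact (PiLp.volume_preserving_ofLp (Fin d)).measurable
    (MeasurableSet.univ_pi fun i => measurableSet_Ico)

theorem volume_gridCube {ε : ℝ} (hε : 0 < ε) (k : Fin d → ℤ) :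
    volume (gridCube ε k) = ENNReal.ofReal (ε ^ d) := by
  rw [gridCube_eq_preimage hε, (PiLp.volume_preserving_ofLp (Fin d)).measure_preimage
    (MeasurableSet.univ_pi fun i => measurableSet_Ico).nullMeasurableSet, Real.volume_pi_Ico]
  ring_nf
  simp [ENNReal.ofReal_pow hε.le]

theorem norm_sub_le_of_mem_gridCube {ε : ℝ} (hε : 0 < ε) {k : Fin d → ℤ}
    {x y : EuclideanSpace ℝ (Fin d)} (hx : x ∈ gridCube ε k) (hy : y ∈ gridCube ε k) :
    ‖y - x‖ ≤ (d + 1) * ε := by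
  rw [gridCube_eq_preimage hε] at hx hy
  simp only [Set.mem_preimage, Set.mem_univ_pi, Set.mem_Ico] at hx hy
  rw [EuclideanSpace.norm_eq]
  refine Real.sqrt_le_iff.2 ⟨by positivity, ?_⟩
  have h : ∀ i ∈ Finset.univ, ‖(y - x) i‖ ^ 2 ≤ ε ^ 2 := fun i _ => by
    rw [Real.norm_eq_abs, sq_abs]
    refine sq_le_sq' ?_ ?_ <;> simp only [PiLp.sub_apply] <;> nlinarith [hx i, hy i]
  refine (Finset.sum_le_sum h).trans ?_
  simp only [Finset.sum_const, Finset.card_univ, Fintype.card_fin, nsmul_eq_mul]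
  have : (0 : ℝ) ≤ d := Nat.cast_nonneg d
  -- The diameter bound √d ε is relaxed to (d + 1)ε, through d ≤ (d + 1)².
  nlinarith [sq_nonneg ε, mul_nonneg (sq_nonneg ε) this,
    mul_nonneg (sq_nonneg ε) (mul_nonneg this this)]

theorem pairwiseDisjoint_gridCube (ε : ℝ) (s : Set (Fin d → ℤ)) :
    s.PairwiseDisjoint (gridCube ε) := by
  intro k _ l _ hkl
  refine Set.disjoint_left.2 fun x hx hy => hkl ?_
  ext i
  rw [← hx i, ← hy i]

theorem exists_finset_subset_iUnion_gridCube
    (hΩ : Bornology.IsBounded (Ω : Set (EuclideanSpace ℝ (Fin d)))) {ε : ℝ} (hε : 0 < ε) :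
    ∃ s : Finset (Fin d → ℤ), (Ω : Set (EuclideanSpace ℝ (Fin d))) ⊆ ⋃ k ∈ s, gridCube ε k := by
  obtain ⟨R, hR⟩ := hΩ.exists_norm_le
  refine ⟨Fintype.piFinset fun _ => Finset.Icc ⌊-R / ε⌋ ⌊R / ε⌋, fun x hx => ?_⟩
  simp only [Set.mem_iUnion]
  refine ⟨fun i => ⌊x i / ε⌋, ?_, fun i => rfl⟩
  rw [Fintype.mem_piFinset]
  intro i
  have h : |x i| ≤ R := (PiLp.norm_apply_le x i).trans (hR x hx)
  rw [abs_le] at h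
  rw [Finset.mem_Icc]
  constructor <;> gcongr
  · exact h.1
  · exact h.2

/-- Poincaré inequality on a grid of small cubes. -/
theorem TestFunction.sum_lintegral_enorm_sub_average_sq_le (φ : 𝓓(Ω, ℝ)) {ε : ℝ} (hε : 0 < ε)
    (s : Finset (Fin d → ℤ)) :
    ∑ k ∈ s, ∫⁻ x in gridCube ε k, ‖φ x - ⨍ y in gridCube ε k, φ y‖ₑ ^ 2 ≤
      (ENNReal.ofReal (((d : ℝ) + 1) ^ (d + 2)) *
          volume (Metric.ball (0 : EuclideanSpace ℝ (Fin d)) 1)) *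
        ENNReal.ofReal ε ^ 2 * ∫⁻ x, ‖∇ φ x‖ₑ ^ 2 := by
  have hφ := φ.continuous
  have hd : (0 : ℝ) < d + 1 := by positivity
  have hv0 : ENNReal.ofReal (ε ^ d) ≠ 0 := by
    simp only [ne_eq, ENNReal.ofReal_eq_zero, not_le]
    positivity
  -- Differences of points in one cube lie in `B`. The ratio of the volumes of `B` and of a cube is
  -- (d + 1)^d |B₁|, and ‖h‖² ≤ (d + 1)² ε² on `B`; the product is the stated constant.
  set B : Set (EuclideanSpace ℝ (Fin d)) := Metric.closedBall 0 ((d + 1) * ε) with hB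
  calc ∑ k ∈ s, ∫⁻ x in gridCube ε k, ‖φ x - ⨍ y in gridCube ε k, φ y‖ₑ ^ 2
      ≤ ∑ k ∈ s, ∫⁻ x in gridCube ε k, (ENNReal.ofReal (ε ^ d))⁻¹ *
          ∫⁻ h in B, ‖φ x - φ (x + h)‖ₑ ^ 2 := by
        refine Finset.sum_le_sum fun k _ => ?_
        refine (lintegral_enorm_sub_average_sq_le (by rwa [volume_gridCube hε])
          (by simp [volume_gridCube hε])
          (hφ.integrable_of_hasCompactSupport φ.hasCompactSupport).integrableOn).trans ?_
        rw [volume_gridCube hε, ← lintegral_const_mul' _ _ (by simpa using hv0)]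
        refine setLIntegral_mono' (measurableSet_gridCube hε k) fun x hx => ?_
        refine mul_le_mul' le_rfl ?_
        -- Substituting y = x + h replaces the inner integral over the cube by one over `B`, which
        -- no longer depends on the cube; the cubes can then be summed.
        rw [← lintegral_indicator (measurableSet_gridCube hε k),
          ← lintegral_indicator Metric.isClosed_closedBall.measurableSet,
          ← lintegral_add_left_eq_self _ x]
        refine lintegral_mono fun h => ?_
        by_cases hh : x + h ∈ gridCube ε k
        · rw [Set.indicator_of_mem hh, Set.indicator_of_mem]
          have := norm_sub_le_of_mem_gridCube hε hx hh
          simpa [hB] using this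
        · rw [Set.indicator_of_notMem hh]
          exact zero_le
    _ = ∫⁻ x in ⋃ k ∈ s, gridCube ε k, (ENNReal.ofReal (ε ^ d))⁻¹ *
          ∫⁻ h in B, ‖φ x - φ (x + h)‖ₑ ^ 2 :=
        (lintegral_biUnion_finset (pairwiseDisjoint_gridCube ε _)
          (fun k _ => measurableSet_gridCube hε k) _).symm
    _ ≤ ∫⁻ x, (ENNReal.ofReal (ε ^ d))⁻¹ * ∫⁻ h in B, ‖φ x - φ (x + h)‖ₑ ^ 2 :=
        setLIntegral_le_lintegral _ _
    _ = (ENNReal.ofReal (ε ^ d))⁻¹ * ∫⁻ h in B, ∫⁻ x, ‖φ x - φ (x + h)‖ₑ ^ 2 := by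
        rw [lintegral_const_mul' _ _ (by simpa using hv0), lintegral_lintegral_swap
          (Continuous.measurable (by fun_prop)).aemeasurable]
    _ ≤ (ENNReal.ofReal (ε ^ d))⁻¹ * ∫⁻ _ in B, ENNReal.ofReal ((d + 1) * ε) ^ 2 *
          ∫⁻ x, ‖∇ φ x‖ₑ ^ 2 := by
        refine mul_le_mul' le_rfl ?_
        refine setLIntegral_mono' Metric.isClosed_closedBall.measurableSet fun h hh => ?_
        refine (φ.lintegral_enorm_translate_sub_sq_le h).trans ?_
        gcongr
        rw [← ofReal_norm]
        exact ENNReal.ofReal_le_ofReal (by simpa [hB] using hh)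
    _ = _ := by
        rw [lintegral_const, Measure.restrict_apply_univ, hB,
          Measure.addHaar_closedBall _ _ (by positivity), finrank_euclideanSpace_fin, mul_pow,
          ENNReal.ofReal_mul hd.le, ENNReal.ofReal_mul (by positivity), pow_add,
          ENNReal.ofReal_mul (by positivity), mul_pow, ENNReal.ofReal_pow hd.le 2]
        have := ENNReal.inv_mul_cancel hv0 ENNReal.ofReal_ne_top
        calc _ = ((ENNReal.ofReal (ε ^ d))⁻¹ * ENNReal.ofReal (ε ^ d)) *
              (ENNReal.ofReal ((d + 1) ^ d) * ENNReal.ofReal (d + 1) ^ 2 *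
                volume (Metric.ball (0 : EuclideanSpace ℝ (Fin d)) 1) * ENNReal.ofReal ε ^ 2 *
                ∫⁻ x, ‖∇ φ x‖ₑ ^ 2) := by ring
          _ = _ := by rw [this, one_mul]

end Rellich

/-! ### Rellich's theorem by finite-rank approximation -/

section Compactness

open scoped ENNReal

variable {d : ℕ} {Ω : Opens (EuclideanSpace ℝ (Fin d))}

/-- Averaging over a finite family of sets, as a finite rank operator on `L²(μ)`. -/
noncomputable def averagingOperator {α ι : Type*} [MeasurableSpace α] (μ : Measure α)
    [IsFiniteMeasure μ] (A : ι → Set α) (hA : ∀ k, MeasurableSet (A k)) (v : ℝ) (s : Finset ι) :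
    Lp ℝ 2 μ →L[ℝ] Lp ℝ 2 μ :=
  ∑ k ∈ s, (ContinuousLinearMap.toSpanSingleton ℝ
    (v⁻¹ • indicatorConstLp 2 (hA k) (measure_ne_top μ (A k)) (1 : ℝ))).comp
      (innerSL ℝ (indicatorConstLp 2 (hA k) (measure_ne_top μ (A k)) (1 : ℝ)))

theorem isCompactOperator_averagingOperator {α ι : Type*} [MeasurableSpace α] (μ : Measure α)
    [IsFiniteMeasure μ] (A : ι → Set α) (hA : ∀ k, MeasurableSet (A k)) (v : ℝ) (s : Finset ι) :
    IsCompactOperator (averagingOperator μ A hA v s) := by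
  have : averagingOperator μ A hA v s ∈ compactOperator (RingHom.id ℝ) (Lp ℝ 2 μ) (Lp ℝ 2 μ) := by
    refine Submodule.sum_mem _ fun k _ => ?_
    exact IsCompactOperator.comp_clm (f := ContinuousLinearMap.toSpanSingleton ℝ
        (v⁻¹ • indicatorConstLp 2 (hA k) (measure_ne_top μ (A k)) (1 : ℝ)))
      (isCompactOperator_id.continuous_comp (ContinuousLinearMap.continuous _)) _
  exact this

theorem averagingOperator_apply_ae {α ι : Type*} [MeasurableSpace α] (μ : Measure α)
    [IsFiniteMeasure μ] (A : ι → Set α) (hA : ∀ k, MeasurableSet (A k)) (v : ℝ) (s : Finset ι)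
    (u : Lp ℝ 2 μ) :
    averagingOperator μ A hA v s u =ᵐ[μ]
      fun x => ∑ k ∈ s, (A k).indicator (fun _ => v⁻¹ * ∫ y in A k, u y ∂μ) x := by
  have h1 : averagingOperator μ A hA v s u = ∑ k ∈ s, ((∫ y in A k, u y ∂μ) * v⁻¹) •
      indicatorConstLp 2 (hA k) (measure_ne_top μ (A k)) (1 : ℝ) := by
    simp [averagingOperator, L2.inner_indicatorConstLp_one,
      smul_smul]
  rw [h1]
  have h2 : ∀ t : Finset ι, (∑ k ∈ t, ((∫ y in A k, u y ∂μ) * v⁻¹) •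
      indicatorConstLp 2 (hA k) (measure_ne_top μ (A k)) (1 : ℝ) : Lp ℝ 2 μ) =ᵐ[μ]
      fun x => ∑ k ∈ t, (A k).indicator (fun _ => v⁻¹ * ∫ y in A k, u y ∂μ) x := by
    classical
    intro t
    induction t using Finset.induction_on with
    | empty =>
      simp only [Finset.sum_empty]
      exact Lp.coeFn_zero ℝ 2 μ
    | insert k t hk ih =>
      rw [Finset.sum_insert hk]
      refine (Lp.coeFn_add _ _).trans ?_
      filter_upwards [ih, Lp.coeFn_smul ((∫ y in A k, u y ∂μ) * v⁻¹)
        (indicatorConstLp 2 (hA k) (measure_ne_top μ (A k)) (1 : ℝ)),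
        indicatorConstLp_coeFn (p := 2) (hs := hA k) (hμs := measure_ne_top μ (A k)) (c := (1 : ℝ))]
        with x h1 h2 h3
      rw [Pi.add_apply, h1, h2, Finset.sum_insert hk, Pi.smul_apply, h3]
      congr 1
      by_cases hx : x ∈ A k <;> simp [hx, mul_comm]
  exact h2 s

theorem TestFunction.setIntegral_restrict (φ : 𝓓(Ω, ℝ)) {A : Set (EuclideanSpace ℝ (Fin d))}
    (hA : MeasurableSet A) :
    ∫ x in A, φ x ∂(volume.restrict (Ω : Set (EuclideanSpace ℝ (Fin d)))) = ∫ x in A, φ x := by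
  rw [Measure.restrict_restrict hA]
  refine (setIntegral_eq_of_subset_of_forall_sdiff_eq_zero hA Set.inter_subset_left
    fun x hx => ?_).symm
  exact φ.eq_zero_of_notMem fun h => hx.2 ⟨hx.1, h⟩

theorem enorm_testPair_snd_sq (φ : 𝓓(Ω, ℝ)) : ‖(testPair Ω φ).2‖ₑ ^ 2 = ∫⁻ x, ‖∇ φ x‖ₑ ^ 2 := by
  rw [Lp.enorm_sq_eq_lintegral, lintegral_congr_ae (g := fun x => ‖∇ φ x‖ₑ ^ 2)
    ((testPair_snd_ae φ).mono fun x hx => by simp only [hx])]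
  refine setLIntegral_eq_of_support_subset ?_
  intro x hx
  by_contra h
  exact hx (by simp [φ.gradient_eq_zero_of_notMem h])

/-- Dividing by the full volume ε^d is right even for cubes that leave Ω: φ vanishes outside Ω, so
integrating over the part inside Ω gives the full-cube average. -/
theorem TestFunction.enorm_sub_averagingOperator_sq_le
    [IsFiniteMeasure (volume.restrict (Ω : Set (EuclideanSpace ℝ (Fin d))))] (φ : 𝓓(Ω, ℝ))
    {ε : ℝ} (hε : 0 < ε) {s : Finset (Fin d → ℤ)}
    (hs : (Ω : Set (EuclideanSpace ℝ (Fin d))) ⊆ ⋃ k ∈ s, gridCube ε k) :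
    ‖(testPair Ω φ).1 - averagingOperator (volume.restrict (Ω : Set (EuclideanSpace ℝ (Fin d))))
      (gridCube ε) (measurableSet_gridCube hε) (ε ^ d) s (testPair Ω φ).1‖ₑ ^ 2 ≤
        ∑ k ∈ s, ∫⁻ x in gridCube ε k, ‖φ x - ⨍ y in gridCube ε k, φ y‖ₑ ^ 2 := by
  set P := averagingOperator (volume.restrict (Ω : Set (EuclideanSpace ℝ (Fin d)))) (gridCube ε)
    (measurableSet_gridCube hε) (ε ^ d) s with hP
  rw [Lp.enorm_sq_eq_lintegral]
  set F : EuclideanSpace ℝ (Fin d) → ℝ := fun x => φ x - ∑ k ∈ s, (gridCube ε k).indicator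
    (fun _ => (ε ^ d)⁻¹ * ∫ y in gridCube ε k, φ y) x with hF
  have e1 : ∫⁻ x in Ω, ‖((testPair Ω φ).1 - P (testPair Ω φ).1 : Lp ℝ 2 _) x‖ₑ ^ 2 =
      ∫⁻ x in Ω, ‖F x‖ₑ ^ 2 := by
    refine lintegral_congr_ae ?_
    filter_upwards [Lp.coeFn_sub (testPair Ω φ).1 (P (testPair Ω φ).1), testPair_fst_ae φ,
      averagingOperator_apply_ae (volume.restrict (Ω : Set (EuclideanSpace ℝ (Fin d))))
        (gridCube ε) (measurableSet_gridCube hε) (ε ^ d) s (testPair Ω φ).1] with x h1 h2 h3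
    rw [h1, Pi.sub_apply, h2, h3]
    congr 3
    refine Finset.sum_congr rfl fun k _ => ?_
    rw [← φ.setIntegral_restrict (measurableSet_gridCube hε k),
      setIntegral_congr_ae (measurableSet_gridCube hε k)
        ((testPair_fst_ae φ).mono fun x hx _ => hx)]
  rw [e1]
  refine (lintegral_mono_set hs).trans ?_
  rw [lintegral_biUnion_finset (pairwiseDisjoint_gridCube ε _)
      (fun k _ => measurableSet_gridCube hε k)]
  refine Finset.sum_le_sum fun k hk => le_of_eq ?_
  refine setLIntegral_congr_fun (measurableSet_gridCube hε k) fun x hx => ?_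
  simp only [hF]
  rw [Finset.sum_eq_single_of_mem k hk, Set.indicator_of_mem hx, setAverage_eq,
    measureReal_def, volume_gridCube hε, ENNReal.toReal_ofReal (by positivity), smul_eq_mul]
  intro l _ hl
  refine Set.indicator_of_notMem (fun hx' => hl ?_) _
  ext i
  rw [← hx i, ← hx' i]

/-- Approximation of elements of `H¹₀(Ω)` by averages over a fine grid. -/
theorem exists_isCompactOperator_norm_sub_le
    (hΩ : Bornology.IsBounded (Ω : Set (EuclideanSpace ℝ (Fin d)))) :
    ∃ C : ℝ, 0 ≤ C ∧ ∀ ε > 0, ∃ P : Lp ℝ 2 (volume.restrict (Ω : Set (EuclideanSpace ℝ (Fin d))))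
      →L[ℝ] Lp ℝ 2 (volume.restrict (Ω : Set (EuclideanSpace ℝ (Fin d)))),
      IsCompactOperator P ∧ ∀ p ∈ sobolevZero Ω, ‖p.1 - P p.1‖ ≤ C * ε * ‖p.2‖ := by
  have := isFiniteMeasure_restrict_of_isBounded hΩ
  set K : ℝ≥0∞ := ENNReal.ofReal (((d : ℝ) + 1) ^ (d + 2)) *
          volume (Metric.ball (0 : EuclideanSpace ℝ (Fin d)) 1) with hK
  have hKtop : K ≠ ∞ := ENNReal.mul_ne_top ENNReal.ofReal_ne_top
    Metric.isBounded_ball.measure_lt_top.ne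
  refine ⟨√K.toReal, Real.sqrt_nonneg _, fun ε hε => ?_⟩
  obtain ⟨s, hs⟩ := exists_finset_subset_iUnion_gridCube hΩ hε
  refine ⟨averagingOperator _ (gridCube ε) (measurableSet_gridCube hε) (ε ^ d) s,
    isCompactOperator_averagingOperator _ _ _ _ _, fun p hp => ?_⟩
  set P := averagingOperator (volume.restrict (Ω : Set (EuclideanSpace ℝ (Fin d)))) (gridCube ε)
    (measurableSet_gridCube hε) (ε ^ d) s with hP
  have key : ∀ φ : 𝓓(Ω, ℝ), ‖(testPair Ω φ).1 - P (testPair Ω φ).1‖ ≤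
      √K.toReal * ε * ‖(testPair Ω φ).2‖ := by
    intro φ
    have h3 := (φ.enorm_sub_averagingOperator_sq_le hε hs).trans
      (φ.sum_lintegral_enorm_sub_average_sq_le hε s)
    rw [← enorm_testPair_snd_sq, ← hK] at h3
    have h4 := ENNReal.toReal_mono (by finiteness) h3
    simp only [ENNReal.toReal_pow, toReal_enorm, ENNReal.toReal_mul,
      ENNReal.toReal_ofReal hε.le] at h4
    refine le_of_sq_le_sq ?_ (by positivity)
    rwa [mul_pow, mul_pow, Real.sq_sqrt ENNReal.toReal_nonneg]
  obtain ⟨φ, hφ⟩ := exists_tendsto_of_mem_sobolevZero hp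
  refine le_of_tendsto_of_tendsto' (b := atTop)
    (f := fun n => ‖(testPair Ω (φ n)).1 - P (testPair Ω (φ n)).1‖)
    (g := fun n => √K.toReal * ε * ‖(testPair Ω (φ n)).2‖) ?_ ?_ fun n => key (φ n)
  · exact ((by fun_prop : Continuous fun p : Lp ℝ 2 (volume.restrict
      (Ω : Set (EuclideanSpace ℝ (Fin d)))) × Lp (EuclideanSpace ℝ (Fin d)) 2 (volume.restrict
      (Ω : Set (EuclideanSpace ℝ (Fin d)))) => ‖p.1 - P p.1‖).tendsto p).comp hφ
  · exact ((by fun_prop : Continuous fun p : Lp ℝ 2 (volume.restrict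
      (Ω : Set (EuclideanSpace ℝ (Fin d)))) × Lp (EuclideanSpace ℝ (Fin d)) 2 (volume.restrict
      (Ω : Set (EuclideanSpace ℝ (Fin d)))) => √K.toReal * ε * ‖p.2‖).tendsto p).comp hφ

/-- `J` is the operator-norm limit of the compact operators `P n ∘ J`, taking ε = 1/(n + 1). -/
theorem isCompactOperator_of_approx {Z X : Type*} [NormedAddCommGroup Z] [NormedSpace ℝ Z]
    [NormedAddCommGroup X] [NormedSpace ℝ X] [CompleteSpace X] (J : Z →L[ℝ] X) {C : ℝ} (hC : 0 ≤ C)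
    (hP : ∀ ε > 0, ∃ P : X →L[ℝ] X, IsCompactOperator P ∧
      ∀ z, ‖J z - P (J z)‖ ≤ C * ε * ‖z‖) : IsCompactOperator J := by
  choose P hPc hPe using fun n : ℕ => hP (1 / ((n : ℝ) + 1)) (by positivity)
  have hlim : Tendsto (fun n => (P n).comp J) atTop (𝓝 J) := by
    rw [tendsto_iff_norm_sub_tendsto_zero]
    refine squeeze_zero (fun _ => norm_nonneg _) (g := fun n : ℕ => C * (1 / ((n : ℝ) + 1)))
      (fun n => ?_) (by simpa using tendsto_one_div_add_atTop_nhds_zero_nat.const_mul C)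
    refine ContinuousLinearMap.opNorm_le_bound _ (by positivity) fun q => ?_
    rw [← norm_neg]
    refine (le_of_eq ?_).trans (hPe n q)
    simp
  exact isCompactOperator_of_tendsto hlim (Eventually.of_forall fun n => (hPc n).comp_clm J)

theorem exists_subseq_tendsto_of_isCompactOperator {Z X : Type*} [NormedAddCommGroup Z]
    [NormedSpace ℝ Z] [NormedAddCommGroup X] [NormedSpace ℝ X] {J : Z →L[ℝ] X}
    (hJ : IsCompactOperator J) {z : ℕ → Z} {R : ℝ} (hz : ∀ n, ‖z n‖ ≤ R) :
    ∃ a, ∃ σ : ℕ → ℕ, StrictMono σ ∧ Tendsto (fun n => J (z (σ n))) atTop (𝓝 a) := by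
  have hK := IsCompactOperator.isCompact_closure_image_closedBall (f := (J : Z →ₗ[ℝ] X)) hJ R
  obtain ⟨a, -, σ, hσ, ha⟩ := hK.tendsto_subseq (x := fun n => J (z n)) fun n =>
    subset_closure ⟨z n, by simpa using hz n, rfl⟩
  exact ⟨a, σ, hσ, ha⟩

/-- If the first projection of a subspace `V ⊆ X × Y` is approximated by compact operators, then
bounded sequences in `V` have subsequences whose first components converge. -/
theorem exists_subseq_tendsto_fst {X Y : Type*} [NormedAddCommGroup X] [NormedSpace ℝ X]
    [CompleteSpace X] [NormedAddCommGroup Y] [NormedSpace ℝ Y] (V : Submodule ℝ (X × Y))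
    (C : ℝ) (hC : 0 ≤ C)
    (hP : ∀ ε > 0, ∃ P : X →L[ℝ] X, IsCompactOperator P ∧
      ∀ p ∈ V, ‖p.1 - P p.1‖ ≤ C * ε * ‖p.2‖)
    (p : ℕ → X × Y) (hp : ∀ n, p n ∈ V) (hbdd : ∃ C, ∀ n, ‖p n‖ ≤ C) :
    ∃ a, ∃ σ : ℕ → ℕ, StrictMono σ ∧ Tendsto (fun n => (p (σ n)).1) atTop (𝓝 a) := by
  obtain ⟨R, hR⟩ := hbdd
  have hbound : ∀ q : V, ‖((LinearMap.fst ℝ X Y).comp V.subtype) q‖ ≤ 1 * ‖q‖ := fun q => by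
    rw [one_mul]
    exact norm_fst_le (q : X × Y)
  refine exists_subseq_tendsto_of_isCompactOperator (isCompactOperator_of_approx
    (((LinearMap.fst ℝ X Y).comp V.subtype).mkContinuous 1 hbound) hC fun ε hε => ?_)
    (z := fun n => (⟨p n, hp n⟩ : V)) hR
  obtain ⟨P, hPc, hPe⟩ := hP ε hε
  refine ⟨P, hPc, fun q => (hPe q q.2).trans ?_⟩
  gcongr
  exact norm_snd_le (q : X × Y)

/-- Rellich's theorem: bounded sequences in `H¹₀(Ω)` have `L²`-convergent subsequences. -/
theorem exists_subseq_tendsto_of_mem_sobolevZero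
    (hΩ : Bornology.IsBounded (Ω : Set (EuclideanSpace ℝ (Fin d))))
    (p : ℕ → Lp ℝ 2 (volume.restrict (Ω : Set (EuclideanSpace ℝ (Fin d)))) ×
      Lp (EuclideanSpace ℝ (Fin d)) 2 (volume.restrict (Ω : Set (EuclideanSpace ℝ (Fin d)))))
    (hp : ∀ n, p n ∈ sobolevZero Ω) (hbdd : ∃ C, ∀ n, ‖p n‖ ≤ C) :
    ∃ a, ∃ σ : ℕ → ℕ, StrictMono σ ∧ Tendsto (fun n => (p (σ n)).1) atTop (𝓝 a) := by
  obtain ⟨C, hC, hP⟩ := exists_isCompactOperator_norm_sub_le hΩ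
  exact exists_subseq_tendsto_fst (sobolevZero Ω) C hC hP p hp hbdd

end Compactness

/-! ### Strong maximum principle by monotone radial averages -/

section StrongMaximumPrinciple

variable {d : ℕ} {Ω : Opens (EuclideanSpace ℝ (Fin d))}

/-- The Laplacian of a smooth function, as the trace of its second derivative. -/
noncomputable def laplace (ψ : EuclideanSpace ℝ (Fin d) → ℝ) (y : EuclideanSpace ℝ (Fin d)) : ℝ :=
  ∑ i, fderiv ℝ (fun z => fderiv ℝ ψ z (EuclideanSpace.single i 1)) y (EuclideanSpace.single i 1)

/-- H serves as the profile of a radial test function and f = -H' as an averaging kernel. The bounds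
on f and τ f'(τ) allow differentiation under the integral in the scale. -/
theorem exists_radial_profile : ∃ (H f f' : ℝ → ℝ) (M : ℝ), ContDiff ℝ (⊤ : ℕ∞) H ∧
    (∀ τ, HasDerivAt H (-f τ) τ) ∧ (∀ τ, HasDerivAt f (f' τ) τ) ∧ Continuous f' ∧
    (∀ τ, 0 ≤ H τ) ∧ (∀ τ, 0 ≤ f τ) ∧ (∀ τ, 1 ≤ τ → H τ = 0 ∧ f τ = 0) ∧
    (∀ τ, τ < 1 → 0 < f τ) ∧ ∀ τ, 0 ≤ τ → f τ ≤ M ∧ |τ * f' τ| ≤ M := by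
  -- The functions p(1/(1 - τ)) exp(-1/(1 - τ)), extended by 0 for τ ≥ 1, are closed under
  -- differentiation. Here H is `G 1` and f is `G P` with P = X².
  set G : Polynomial ℝ → ℝ → ℝ := fun p τ => p.eval (1 - τ)⁻¹ * expNegInvGlue (1 - τ) with hG
  have hder : ∀ (p : Polynomial ℝ) (τ : ℝ),
      HasDerivAt (G p) (-G (Polynomial.X ^ 2 * (p - Polynomial.derivative p)) τ) τ := fun p τ => by
    have h1 : HasDerivAt (fun τ : ℝ => 1 - τ) (-1) τ := by
      simpa using (hasDerivAt_id τ).const_sub 1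
    have h2 := (expNegInvGlue.hasDerivAt_polynomial_eval_inv_mul p (1 - τ)).comp τ h1
    simpa [hG, Function.comp_def] using h2
  have hzero : ∀ (p : Polynomial ℝ) (τ : ℝ), 1 ≤ τ → G p τ = 0 := fun p τ hτ => by
    simp only [hG]
    rw [expNegInvGlue.zero_of_nonpos (by linarith), mul_zero]
  have hcont : ∀ p, Continuous (G p) := fun p =>
    (expNegInvGlue.continuous_polynomial_eval_inv_mul p).comp (by fun_prop)
  set P : Polynomial ℝ := Polynomial.X ^ 2 * (1 - Polynomial.derivative 1) with hP
  have hPv : ∀ τ, G P τ = ((1 - τ)⁻¹) ^ 2 * expNegInvGlue (1 - τ) := fun τ => by simp [hG, hP]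
  set Q : Polynomial ℝ := Polynomial.X ^ 2 * (P - Polynomial.derivative P) with hQ
  obtain ⟨M₁, hM₁⟩ := (isCompact_Icc (a := (0 : ℝ)) (b := 1)).exists_bound_of_continuousOn
    (hcont P).continuousOn
  obtain ⟨M₂, hM₂⟩ := (isCompact_Icc (a := (0 : ℝ)) (b := 1)).exists_bound_of_continuousOn
    (f := fun τ => τ * G Q τ) (by fun_prop)
  have hM₁0 : 0 ≤ M₁ := (norm_nonneg _).trans (hM₁ 0 (by simp))
  refine ⟨G 1, G P, fun τ => -G Q τ, max M₁ M₂, ?_, fun τ => hder 1 τ, fun τ => hder P τ,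
    (hcont Q).neg, fun τ => ?_, fun τ => ?_, fun τ hτ => ⟨hzero _ _ hτ, hzero _ _ hτ⟩,
    fun τ hτ => ?_, fun τ hτ => ?_⟩
  · exact (expNegInvGlue.contDiff_polynomial_eval_inv_mul 1).comp (by fun_prop)
  · simpa [hG] using expNegInvGlue.nonneg _
  · rw [hPv]
    exact mul_nonneg (sq_nonneg _) (expNegInvGlue.nonneg _)
  · rw [hPv]
    have : 0 < 1 - τ := by linarith
    exact mul_pos (by positivity) (expNegInvGlue.pos_of_pos this)
  · rcases le_total τ 1 with h1 | h1
    · refine ⟨(le_abs_self _).trans ((hM₁ τ ⟨hτ, h1⟩).trans (le_max_left _ _)), ?_⟩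
      rw [mul_neg, abs_neg]
      exact (hM₂ τ ⟨hτ, h1⟩).trans (le_max_right _ _)
    · simp only [hzero P τ h1, hzero Q τ h1]
      simp [hM₁0]

theorem hasFDerivAt_comp_mul_norm_sub_sq {h h' : ℝ → ℝ} (hh : ∀ τ, HasDerivAt h (h' τ) τ) (r : ℝ)
    (x y : EuclideanSpace ℝ (Fin d)) :
    HasFDerivAt (fun y => h (r ^ 2 * ‖y - x‖ ^ 2))
      ((h' (r ^ 2 * ‖y - x‖ ^ 2)) • (r ^ 2 • (2 • (innerSL ℝ (y - x))))) y := by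
  have h1 : HasFDerivAt (fun y : EuclideanSpace ℝ (Fin d) => ‖y - x‖ ^ 2)
      (2 • (innerSL ℝ (y - x))) y := by
    have := ((hasFDerivAt_id y).sub_const x).norm_sq
    simpa using this
  exact (hh _).comp_hasFDerivAt y (h1.const_mul (r ^ 2))

theorem laplace_comp_mul_norm_sub_sq {H f f' : ℝ → ℝ} (hH : ∀ τ, HasDerivAt H (-f τ) τ)
    (hf : ∀ τ, HasDerivAt f (f' τ) τ) (r : ℝ) (x y : EuclideanSpace ℝ (Fin d)) :
    laplace (fun y => H (r ^ 2 * ‖y - x‖ ^ 2)) y =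
      -(2 * r ^ 2 * (d * f (r ^ 2 * ‖y - x‖ ^ 2) +
        2 * (r ^ 2 * ‖y - x‖ ^ 2 * f' (r ^ 2 * ‖y - x‖ ^ 2)))) := by
  have h1 : ∀ i (z : EuclideanSpace ℝ (Fin d)),
      fderiv ℝ (fun y => H (r ^ 2 * ‖y - x‖ ^ 2)) z (EuclideanSpace.single i 1) =
        (-(2 * r ^ 2)) * ((z i - x i) * f (r ^ 2 * ‖z - x‖ ^ 2)) := fun i z => by
    rw [(hasFDerivAt_comp_mul_norm_sub_sq hH r x z).fderiv]
    simp [EuclideanSpace.inner_single_right]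
    ring
  have h2 : ∀ i, fderiv ℝ (fun z => fderiv ℝ (fun y => H (r ^ 2 * ‖y - x‖ ^ 2)) z
      (EuclideanSpace.single i 1)) y (EuclideanSpace.single i 1) =
      (-(2 * r ^ 2)) * (f (r ^ 2 * ‖y - x‖ ^ 2) +
        2 * (r ^ 2 * (y i - x i) ^ 2 * f' (r ^ 2 * ‖y - x‖ ^ 2))) := fun i => by
    simp only [h1]
    have h3 : HasFDerivAt (fun z : EuclideanSpace ℝ (Fin d) => z i - x i)
        (EuclideanSpace.proj i : EuclideanSpace ℝ (Fin d) →L[ℝ] ℝ) y :=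
      (EuclideanSpace.proj i : EuclideanSpace ℝ (Fin d) →L[ℝ] ℝ).hasFDerivAt.sub_const _
    have h4 : HasFDerivAt (fun z : EuclideanSpace ℝ (Fin d) =>
        -(2 * r ^ 2) * ((z i - x i) * f (r ^ 2 * ‖z - x‖ ^ 2))) _ y :=
      (h3.mul (hasFDerivAt_comp_mul_norm_sub_sq hf r x y)).const_mul (-(2 * r ^ 2))
    rw [h4.fderiv]
    simp [EuclideanSpace.inner_single_right]
    ring
  have h3 : ‖y - x‖ ^ 2 = ∑ i, (y i - x i) ^ 2 := by simp [EuclideanSpace.norm_sq_eq]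
  simp only [laplace, h2]
  rw [← Finset.mul_sum, Finset.sum_add_distrib, ← Finset.mul_sum, ← Finset.sum_mul,
    ← Finset.mul_sum, ← h3]
  simp

theorem exists_radial_testFunction {H : ℝ → ℝ} (hH : ContDiff ℝ (⊤ : ℕ∞) H)
    (hH1 : ∀ τ, 1 ≤ τ → H τ = 0) {r : ℝ} (hr : 0 < r) {x : EuclideanSpace ℝ (Fin d)}
    (hx : Metric.closedBall x r⁻¹ ⊆ Ω) :
    ∃ ψ : 𝓓(Ω, ℝ), ∀ y, ψ y = H (r ^ 2 * ‖y - x‖ ^ 2) := by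
  have hsupp : tsupport (fun y => H (r ^ 2 * ‖y - x‖ ^ 2)) ⊆ Metric.closedBall x r⁻¹ := by
    refine closure_minimal (fun y hy => ?_) Metric.isClosed_closedBall
    by_contra h
    rw [Metric.mem_closedBall, dist_eq_norm, not_le, inv_lt_iff_one_lt_mul₀ hr] at h
    refine hy (hH1 _ ?_)
    rw [← mul_pow, mul_comm]
    exact one_le_pow₀ h.le
  refine ⟨⟨fun y => H (r ^ 2 * ‖y - x‖ ^ 2), ?_, ?_, hsupp.trans hx⟩, fun y => rfl⟩
  · refine hH.comp (contDiff_const.mul ?_)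
    exact (contDiff_id.sub contDiff_const).norm_sq ℝ
  · exact HasCompactSupport.of_support_subset_isCompact (isCompact_closedBall x r⁻¹)
      (subset_tsupport _ |>.trans hsupp)

/-- The r-derivative of the kernel r^d f(r²|y - x|²) is a nonpositive multiple of the Laplacian of
the test function H(r²|y - x|²), so superharmonicity makes the integral increase. Here r is the
inverse radius, and r^d keeps the mass of the kernel independent of r. -/
theorem monotoneOn_integral_mul_radial {H f f' : ℝ → ℝ} {M : ℝ} (hHs : ContDiff ℝ (⊤ : ℕ∞) H)
    (hH : ∀ τ, HasDerivAt H (-f τ) τ) (hf : ∀ τ, HasDerivAt f (f' τ) τ) (hf' : Continuous f')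
    (hH0 : ∀ τ, 0 ≤ H τ) (hf0 : ∀ τ, 0 ≤ f τ) (hH1 : ∀ τ, 1 ≤ τ → H τ = 0)
    (hM : ∀ τ, 0 ≤ τ → f τ ≤ M ∧ |τ * f' τ| ≤ M)
    {W : EuclideanSpace ℝ (Fin d) → ℝ} (hW : Integrable W)
    (hsup : ∀ ψ : 𝓓(Ω, ℝ), (∀ y, 0 ≤ ψ y) → ∫ y, W y * laplace ψ y ≤ 0)
    {r₀ : ℝ} (hr₀ : 0 < r₀) {x : EuclideanSpace ℝ (Fin d)}
    (hx : Metric.closedBall x r₀⁻¹ ⊆ Ω) :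
    MonotoneOn (fun r : ℝ => ∫ y, W y * (r ^ d * f (r ^ 2 * ‖y - x‖ ^ 2))) (Set.Ici r₀) := by
  have hfc : Continuous f := continuous_iff_continuousAt.2 fun τ => (hf τ).continuousAt
  set F' : ℝ → EuclideanSpace ℝ (Fin d) → ℝ := fun r y =>
    W y * (d * r ^ (d - 1) * f (r ^ 2 * ‖y - x‖ ^ 2) +
      r ^ d * (f' (r ^ 2 * ‖y - x‖ ^ 2) * (2 * r * ‖y - x‖ ^ 2))) with hF'
  have hder : ∀ r, r₀ ≤ r → HasDerivAt
      (fun r : ℝ => ∫ y, W y * (r ^ d * f (r ^ 2 * ‖y - x‖ ^ 2))) (∫ y, F' r y) r := by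
    intro r hr
    have hrpos : 0 < r := hr₀.trans_le hr
    have hcont : ∀ r : ℝ, Continuous fun y => r ^ d * f (r ^ 2 * ‖y - x‖ ^ 2) := fun r => by
      fun_prop
    refine (hasDerivAt_integral_of_dominated_loc_of_deriv_le (s := Set.Ioo (r / 2) (r + 1))
      (bound := fun y => ‖W y‖ * (d * (r + 1) ^ (d - 1) * M + (r + 1) ^ d * (2 * M * (2 / r))))
      (Ioo_mem_nhds (by linarith) (by linarith)) ?_ ?_ ?_ ?_ ?_ ?_).2
    · exact Eventually.of_forall fun r =>
        hW.aestronglyMeasurable.mul (hcont r).aestronglyMeasurable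
    · refine hW.mul_bdd (c := r ^ d * M) (hcont r).aestronglyMeasurable
        (Eventually.of_forall fun y => ?_)
      rw [Real.norm_eq_abs, abs_of_nonneg (mul_nonneg (by positivity) (hf0 _))]
      gcongr
      exact (hM _ (by positivity)).1
    · exact hW.aestronglyMeasurable.mul (Continuous.aestronglyMeasurable (by fun_prop))
    · refine Eventually.of_forall fun y s hs => ?_
      have hs0 : 0 < s := lt_trans (by positivity) hs.1
      have hτ : 0 ≤ s ^ 2 * ‖y - x‖ ^ 2 := by positivity
      obtain ⟨hM1, hM2⟩ := hM _ hτ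
      have hM0 : 0 ≤ M := (abs_nonneg _).trans hM2
      -- Regrouping exposes τ f'(τ), which is bounded by M uniformly in y; the remaining s⁻¹ is
      -- controlled by s > r/2.
      have e1 : f' (s ^ 2 * ‖y - x‖ ^ 2) * (2 * s * ‖y - x‖ ^ 2) =
          2 * ((s ^ 2 * ‖y - x‖ ^ 2) * f' (s ^ 2 * ‖y - x‖ ^ 2)) * s⁻¹ := by
        field_simp
      have e2 : s⁻¹ ≤ 2 / r := by
        rw [inv_le_comm₀ hs0 (by positivity), inv_div]
        exact hs.1.le
      simp only [hF']
      rw [norm_mul]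
      refine mul_le_mul_of_nonneg_left ?_ (norm_nonneg _)
      refine (norm_add_le _ _).trans (add_le_add ?_ ?_)
      · rw [Real.norm_eq_abs, abs_of_nonneg (mul_nonneg (by positivity) (hf0 _))]
        have := hs.2.le
        have := hf0 (s ^ 2 * ‖y - x‖ ^ 2)
        gcongr
      · rw [e1, norm_mul, norm_mul, norm_mul, Real.norm_of_nonneg (by positivity : 0 ≤ s ^ d),
          Real.norm_of_nonneg (by positivity : 0 ≤ s⁻¹), Real.norm_eq_abs, Real.norm_eq_abs,
          abs_two]
        have := hs.2.le
        gcongr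
    · exact hW.norm.mul_const _
    · refine Eventually.of_forall fun y s _ => ?_
      have h1 : HasDerivAt (fun s : ℝ => s ^ 2 * ‖y - x‖ ^ 2) (2 * s * ‖y - x‖ ^ 2) s := by
        simpa using (hasDerivAt_pow 2 s).mul_const (‖y - x‖ ^ 2)
      exact ((hasDerivAt_pow d s).mul ((hf _).comp s h1)).const_mul (W y)
  refine monotoneOn_of_deriv_nonneg (convex_Ici r₀)
    (fun r hr => (hder r hr).continuousAt.continuousWithinAt)
    (fun r hr => (hder r (interior_subset hr)).differentiableAt.differentiableWithinAt)
    fun r hr => ?_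
  have hr' : r₀ ≤ r := interior_subset hr
  have hrpos : 0 < r := hr₀.trans_le hr'
  rw [(hder r hr').deriv]
  obtain ⟨ψ, hψ⟩ := exists_radial_testFunction (Ω := Ω) (x := x) hHs hH1 hrpos
    ((Metric.closedBall_subset_closedBall (by gcongr)).trans hx)
  have hψ' : (ψ : EuclideanSpace ℝ (Fin d) → ℝ) = fun y => H (r ^ 2 * ‖y - x‖ ^ 2) := funext hψ
  have hs := hsup ψ fun y => by rw [hψ]; exact hH0 _
  rw [hψ'] at hs
  -- With τ = r²|y - x|², the kernel derivative is r^(d-1)(d f + 2τ f') and the Laplacian is -2r²(d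
  -- f + 2τ f'). The form r^d / (2r³) avoids the truncated exponent d - 1 when d = 0.
  have hrel : ∀ y, F' r y = (-(r ^ d / (2 * r ^ 3))) *
      (W y * laplace (fun y => H (r ^ 2 * ‖y - x‖ ^ 2)) y) := fun y => by
    rw [laplace_comp_mul_norm_sub_sq hH hf]
    simp only [hF']
    rcases Nat.eq_zero_or_pos d with h0 | h0
    · subst h0
      simp
      field_simp
    · obtain ⟨e, rfl⟩ := Nat.exists_eq_succ_of_ne_zero h0.ne'
      simp only [Nat.succ_eq_add_one, Nat.add_sub_cancel]
      field_simp
      ring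
  simp only [hrel]
  rw [integral_const_mul]
  exact mul_nonneg_of_nonpos_of_nonpos (by simp only [Left.neg_nonpos_iff]; positivity) hs

theorem exists_radial_kernel (Ω : Opens (EuclideanSpace ℝ (Fin d)))
    {W : EuclideanSpace ℝ (Fin d) → ℝ} (hW : Integrable W)
    (hsup : ∀ ψ : 𝓓(Ω, ℝ), (∀ y, 0 ≤ ψ y) → ∫ y, W y * laplace ψ y ≤ 0) :
    ∃ (f : ℝ → ℝ) (M : ℝ), Continuous f ∧ (∀ τ, 0 ≤ f τ) ∧ (∀ τ, 1 ≤ τ → f τ = 0) ∧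
      (∀ τ, τ < 1 → 0 < f τ) ∧ (∀ τ, 0 ≤ τ → f τ ≤ M) ∧ ∀ r₀ > 0, ∀ x,
      Metric.closedBall x r₀⁻¹ ⊆ Ω →
        MonotoneOn (fun r : ℝ => ∫ y, W y * (r ^ d * f (r ^ 2 * ‖y - x‖ ^ 2))) (Set.Ici r₀) := by
  obtain ⟨H, f, f', M, hHs, hH, hf, hf', hH0, hf0, hz, hpos, hM⟩ := exists_radial_profile
  refine ⟨f, M, continuous_iff_continuousAt.2 fun τ => (hf τ).continuousAt, hf0,
    fun τ hτ => (hz τ hτ).2, hpos, fun τ hτ => (hM τ hτ).1, fun r₀ hr₀ x hx => ?_⟩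
  exact monotoneOn_integral_mul_radial hHs hH hf hf' hH0 hf0 (fun τ hτ => (hz τ hτ).1) hM hW hsup
    hr₀ hx

/-- A nonnegative superharmonic function that vanishes at a Lebesgue point vanishes on every ball
around that point. -/
theorem ae_eq_zero_on_ball_of_superharmonic {W : EuclideanSpace ℝ (Fin d) → ℝ}
    (hW : Integrable W) (hW0 : ∀ᵐ y, 0 ≤ W y)
    (hsup : ∀ ψ : 𝓓(Ω, ℝ), (∀ y, 0 ≤ ψ y) → ∫ y, W y * laplace ψ y ≤ 0) :
    ∀ᵐ x, W x = 0 → ∀ ρ > 0, Metric.closedBall x ρ ⊆ Ω →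
      ∀ᵐ y, y ∈ Metric.ball x ρ → W y = 0 := by
  obtain ⟨f, M, hfc, hf0, hf1, hfpos, hM, hmono⟩ := exists_radial_kernel Ω hW hsup
  filter_upwards [IsUnifLocDoublingMeasure.ae_tendsto_average_norm_sub
    (volume : Measure (EuclideanSpace ℝ (Fin d))) hW.locallyIntegrable 1] with x hx hWx ρ hρ hball
  set I : ℝ → ℝ := fun r => ∫ y, W y * (r ^ d * f (r ^ 2 * ‖y - x‖ ^ 2)) with hI
  have hM0 : 0 ≤ M := (hf0 0).trans (hM 0 le_rfl)
  have hint : ∀ r : ℝ, 0 ≤ r → Integrable fun y => W y * (r ^ d * f (r ^ 2 * ‖y - x‖ ^ 2)) := by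
    intro r hr
    refine hW.mul_bdd (c := r ^ d * M) (Continuous.aestronglyMeasurable (by fun_prop))
      (Eventually.of_forall fun y => ?_)
    rw [Real.norm_eq_abs, abs_of_nonneg (mul_nonneg (by positivity) (hf0 _))]
    gcongr
    exact hM _ (by positivity)
  -- The kernel is at most r^d M on the ball of radius 1/r and zero outside, and r^d times the
  -- volume of that ball is |B₁|.
  have hupper : ∀ r : ℝ, 0 < r → I r ≤
      M * volume.real (Metric.ball (0 : EuclideanSpace ℝ (Fin d)) 1) *
        ⨍ y in Metric.closedBall x r⁻¹, ‖W y - W x‖ := by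
    intro r hr
    have h1 : I r ≤ ∫ y in Metric.closedBall x r⁻¹, r ^ d * M * ‖W y - W x‖ := by
      rw [← integral_indicator Metric.isClosed_closedBall.measurableSet]
      refine integral_mono (hint r hr.le) ?_ fun y => ?_
      · simp only [hWx, sub_zero]
        exact (hW.norm.const_mul _).indicator Metric.isClosed_closedBall.measurableSet
      · by_cases hy : y ∈ Metric.closedBall x r⁻¹
        · rw [Set.indicator_of_mem hy, hWx, sub_zero, mul_comm]
          refine (mul_le_mul_of_nonneg_left (le_abs_self (W y))
            (mul_nonneg (by positivity) (hf0 _))).trans ?_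
          refine mul_le_mul_of_nonneg_right ?_ (abs_nonneg _)
          exact mul_le_mul_of_nonneg_left (hM _ (by positivity)) (by positivity)
        · rw [Set.indicator_of_notMem hy]
          rw [Metric.mem_closedBall, dist_eq_norm, not_le, inv_lt_iff_one_lt_mul₀ hr] at hy
          simp only
          rw [hf1, mul_zero, mul_zero]
          rw [← mul_pow, mul_comm]
          exact one_le_pow₀ hy.le
    refine h1.trans (le_of_eq ?_)
    rw [integral_const_mul, setAverage_eq, Measure.addHaar_real_closedBall _ _ (by positivity),
      finrank_euclideanSpace_fin, smul_eq_mul]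
    have : volume.real (Metric.ball (0 : EuclideanSpace ℝ (Fin d)) 1) ≠ 0 := by
      rw [measureReal_def]
      exact (ENNReal.toReal_pos (Metric.measure_ball_pos _ _ one_pos).ne'
        Metric.isBounded_ball.measure_lt_top.ne).ne'
    have hrd : r ^ d ≠ 0 := by positivity
    rw [inv_pow]
    field_simp
  have hlim := hx (l := atTop) (fun _ : ℝ => x) (fun r : ℝ => r⁻¹) tendsto_inv_atTop_nhdsGT_zero
    (by filter_upwards [eventually_ge_atTop 0] with r hr
        exact Metric.mem_closedBall_self (by positivity))
  -- By monotonicity I(1/ρ) ≤ I(r) for r ≥ 1/ρ, and the upper bound for I(r) tends to 0 as r → ∞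
  -- because x is a Lebesgue point with W x = 0.
  have hle : I ρ⁻¹ ≤ 0 := by
    have h2 := hlim.const_mul (M * volume.real (Metric.ball (0 : EuclideanSpace ℝ (Fin d)) 1))
    rw [mul_zero] at h2
    refine ge_of_tendsto h2 ?_
    filter_upwards [eventually_ge_atTop ρ⁻¹] with r hr
    have hρ' : 0 < ρ⁻¹ := by positivity
    refine le_trans ?_ (hupper r (hρ'.trans_le hr))
    exact hmono ρ⁻¹ hρ' x (by rwa [inv_inv]) (Set.self_mem_Ici) hr hr
  have hnn : 0 ≤ᵐ[volume] fun y => W y * (ρ⁻¹ ^ d * f (ρ⁻¹ ^ 2 * ‖y - x‖ ^ 2)) := by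
    filter_upwards [hW0] with y hy
    exact mul_nonneg hy (mul_nonneg (by positivity) (hf0 _))
  have hzero := (integral_eq_zero_iff_of_nonneg_ae hnn (hint _ (by positivity))).1
    (le_antisymm hle (integral_nonneg_of_ae hnn))
  filter_upwards [hzero] with y hy hyb
  have hlt : ρ⁻¹ ^ 2 * ‖y - x‖ ^ 2 < 1 := by
    rw [← mul_pow]
    refine pow_lt_one₀ (by positivity) ?_ two_ne_zero
    rw [inv_mul_lt_iff₀ hρ, mul_one, ← dist_eq_norm]
    exact hyb
  have hpos : 0 < ρ⁻¹ ^ d * f (ρ⁻¹ ^ 2 * ‖y - x‖ ^ 2) := mul_pos (by positivity) (hfpos _ hlt)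
  exact (mul_eq_zero.1 hy).resolve_right hpos.ne'

/-- Strong maximum principle for weakly superharmonic functions. -/
theorem ae_eq_zero_or_pos_of_superharmonic
    (hΩ : IsPreconnected (Ω : Set (EuclideanSpace ℝ (Fin d))))
    {W : EuclideanSpace ℝ (Fin d) → ℝ} (hW : Integrable W) (hW0 : ∀ᵐ y, 0 ≤ W y)
    (hsup : ∀ ψ : 𝓓(Ω, ℝ), (∀ y, 0 ≤ ψ y) → ∫ y, W y * laplace ψ y ≤ 0) :
    (∀ᵐ y, y ∈ Ω → W y = 0) ∨ ∀ᵐ y, y ∈ Ω → 0 < W y := by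
  have hL := ae_eq_zero_on_ball_of_superharmonic hW hW0 hsup
  set Z : Set (EuclideanSpace ℝ (Fin d)) := {x | ∃ ρ > 0, ∀ᵐ y, y ∈ Metric.ball x ρ → W y = 0}
    with hZ
  have hZo : IsOpen Z := by
    refine Metric.isOpen_iff.2 ?_
    rintro x ⟨ρ, hρ, h⟩
    refine ⟨ρ, hρ, fun z hz => ⟨ρ - dist z x, by simpa using hz, ?_⟩⟩
    filter_upwards [h] with y hy hyz
    exact hy (Metric.ball_subset_ball' (by linarith) hyz)
  by_cases hne : ((Ω : Set (EuclideanSpace ℝ (Fin d))) ∩ Z).Nonempty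
  · left
    have hsub : (Ω : Set (EuclideanSpace ℝ (Fin d))) ⊆ Z := by
      refine hΩ.subset_of_closure_inter_subset hZo hne ?_
      rintro x ⟨hxc, hxΩ⟩
      obtain ⟨ρ, hρ, hball⟩ := Metric.isOpen_iff.1 Ω.isOpen x hxΩ
      obtain ⟨z, ⟨δ, hδ, hz⟩, hzx⟩ := Metric.mem_closure_iff.1 hxc (ρ / 4) (by positivity)
      -- To show that Z is closed in Ω, pick near z a point z' where W vanishes and the ball lemma
      -- applies. As z' is within ρ/2 of x, its ball of radius ρ/2 contains x and stays inside Ω.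
      obtain ⟨z', ⟨hz'W, hz'L⟩, hz'm⟩ := (Measure.dense_of_ae (hz.and hL)).inter_nhds_nonempty
        (Metric.ball_mem_nhds z (lt_min hδ (show 0 < ρ / 4 by positivity)))
      have hd1 : dist z' z < δ := lt_of_lt_of_le hz'm (min_le_left _ _)
      have hd2 : dist z' z < ρ / 4 := lt_of_lt_of_le hz'm (min_le_right _ _)
      have hd3 : dist x z' < ρ / 2 := by
        have := dist_triangle x z z'
        rw [dist_comm z z'] at this
        linarith
      have hz0 := hz'L (hz'W hd1) (ρ / 2) (by positivity) (by
        refine (Metric.closedBall_subset_ball' ?_).trans hball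
        rw [dist_comm]
        linarith)
      refine ⟨ρ / 2 - dist x z', by linarith, ?_⟩
      filter_upwards [hz0] with y hy hyx
      exact hy (Metric.ball_subset_ball' (by linarith) hyx)
    refine measure_null_of_locally_null {y | ¬ (y ∈ Ω → W y = 0)} fun x hx => ?_
    obtain ⟨ρ, hρ, h⟩ := hsub (Classical.not_imp.1 hx).1
    refine ⟨{y | ¬ (y ∈ Metric.ball x ρ → W y = 0)}, ?_, h⟩
    filter_upwards [mem_nhdsWithin_of_mem_nhds (Metric.ball_mem_nhds x hρ),
      self_mem_nhdsWithin] with y hy hyW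
    exact fun h' => (Classical.not_imp.1 hyW).2 (h' hy)
  · right
    filter_upwards [hW0, hL] with y hy hyL hyΩ
    refine lt_of_le_of_ne hy fun h => hne ?_
    obtain ⟨ρ, hρ, hball⟩ := Metric.isOpen_iff.1 Ω.isOpen y hyΩ
    refine ⟨y, hyΩ, ρ / 2, by positivity, hyL h.symm _ (by positivity) ?_⟩
    exact (Metric.closedBall_subset_ball (by linarith)).trans hball

end StrongMaximumPrinciple

/-! ### Positive parts and the sign of minimizers -/

section Eigenfunctions

variable {d : ℕ} {Ω : Opens (EuclideanSpace ℝ (Fin d))}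

namespace TestFunction

/-- The directional derivative of a test function. -/
noncomputable def dirDeriv (φ : 𝓓(Ω, ℝ)) (v : EuclideanSpace ℝ (Fin d)) : 𝓓(Ω, ℝ) where
  toFun x := fderiv ℝ φ x v
  contDiff' := (φ.contDiff.fderiv_right (m := ((⊤ : ℕ∞) : WithTop ℕ∞)) (by simp)).clm_apply
    contDiff_const
  hasCompactSupport' := φ.hasCompactSupport.fderiv_apply ℝ v
  tsupport_subset' := (tsupport_fderiv_apply_subset ℝ v).trans φ.tsupport_subset

theorem dirDeriv_apply (φ : 𝓓(Ω, ℝ)) (v x : EuclideanSpace ℝ (Fin d)) :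
    φ.dirDeriv v x = fderiv ℝ φ x v := rfl

/-- A smooth approximation of the positive part of a test function. -/
noncomputable def smoothPosPart (δ : ℝ) (hδ : 0 < δ) (φ : 𝓓(Ω, ℝ)) : 𝓓(Ω, ℝ) where
  toFun x := (√(φ x ^ 2 + δ ^ 2) - δ + φ x) / 2
  contDiff' := by
    have h := φ.contDiff
    refine (((ContDiff.sqrt (by fun_prop) fun x => ?_).sub contDiff_const).add h).div_const _
    positivity
  hasCompactSupport' := φ.hasCompactSupport.comp_left
    (g := fun t : ℝ => (√(t ^ 2 + δ ^ 2) - δ + t) / 2) (by simp [Real.sqrt_sq hδ.le])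
  tsupport_subset' := (tsupport_comp_subset
    (g := fun t : ℝ => (√(t ^ 2 + δ ^ 2) - δ + t) / 2) (by simp [Real.sqrt_sq hδ.le]) φ).trans
    φ.tsupport_subset

theorem smoothPosPart_apply {δ : ℝ} (hδ : 0 < δ) (φ : 𝓓(Ω, ℝ)) (x : EuclideanSpace ℝ (Fin d)) :
    φ.smoothPosPart δ hδ x = (√(φ x ^ 2 + δ ^ 2) - δ + φ x) / 2 := rfl

theorem abs_smoothPosPart_sub_le {δ : ℝ} (hδ : 0 < δ) (φ : 𝓓(Ω, ℝ))
    (x : EuclideanSpace ℝ (Fin d)) : |φ.smoothPosPart δ hδ x - max (φ x) 0| ≤ δ := by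
  rw [smoothPosPart_apply]
  have h1 : |φ x| ≤ √(φ x ^ 2 + δ ^ 2) := Real.abs_le_sqrt (by nlinarith)
  have h2 : √(φ x ^ 2 + δ ^ 2) ≤ |φ x| + δ := by
    refine Real.sqrt_le_iff.2 ⟨by positivity, ?_⟩
    nlinarith [sq_abs (φ x), mul_nonneg (abs_nonneg (φ x)) hδ.le]
  rw [abs_le]
  rcases le_total 0 (φ x) with h | h
  · rw [max_eq_left h]
    rw [abs_of_nonneg h] at h1 h2
    constructor <;> linarith
  · rw [max_eq_right h]
    rw [abs_of_nonpos h] at h1 h2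
    constructor <;> linarith

theorem gradient_smoothPosPart {δ : ℝ} (hδ : 0 < δ) (φ : 𝓓(Ω, ℝ))
    (x : EuclideanSpace ℝ (Fin d)) :
    ∇ (φ.smoothPosPart δ hδ) x = ((φ x / √(φ x ^ 2 + δ ^ 2) + 1) / 2) • ∇ φ x := by
  have h : HasDerivAt (fun t : ℝ => (√(t ^ 2 + δ ^ 2) - δ + t) / 2)
      ((φ x / √(φ x ^ 2 + δ ^ 2) + 1) / 2) (φ x) := by
    have h1 : HasDerivAt (fun t : ℝ => t ^ 2 + δ ^ 2) (2 * φ x) (φ x) := by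
      simpa using (hasDerivAt_pow 2 (φ x)).add_const (δ ^ 2)
    have h2 := (((h1.sqrt (by positivity)).sub_const δ).add (hasDerivAt_id (φ x))).div_const 2
    convert! h2 using 2
    field_simp
  have h3 := h.comp_hasFDerivAt x (φ.differentiable x).hasFDerivAt
  rw [gradient, gradient, ← map_smul]
  congr 1
  exact h3.fderiv

/-- With a = φ/√(φ² + δ²), the two gradients are (1 ± a)/2 times ∇φ up to sign, and the squared
factors sum to (1 + a²)/2 ≤ 1. This splitting of the energy stands in for the chain rule for the
positive part. -/
theorem norm_gradient_smoothPosPart_sq_add_le {δ : ℝ} (hδ : 0 < δ) (φ : 𝓓(Ω, ℝ))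
    (x : EuclideanSpace ℝ (Fin d)) :
    ‖∇ (φ.smoothPosPart δ hδ) x‖ ^ 2 + ‖∇ ((-φ).smoothPosPart δ hδ) x‖ ^ 2 ≤ ‖∇ φ x‖ ^ 2 := by
  have hneg : ∇ (-φ : 𝓓(Ω, ℝ)) x = -∇ φ x := by
    have := congrFun (gradient_smul (-1) φ) x
    simpa using this
  have hneg' : (-φ : 𝓓(Ω, ℝ)) x = -φ x := rfl
  rw [gradient_smoothPosPart, gradient_smoothPosPart, hneg, hneg', norm_smul, norm_smul, norm_neg,
    neg_sq]
  have h1 : |φ x / √(φ x ^ 2 + δ ^ 2)| ≤ 1 := by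
    rw [abs_div, abs_of_nonneg (Real.sqrt_nonneg _)]
    exact div_le_one_of_le₀ (Real.abs_le_sqrt (by nlinarith)) (Real.sqrt_nonneg _)
  rw [neg_div]
  set a := φ x / √(φ x ^ 2 + δ ^ 2)
  rw [mul_pow, mul_pow, ← add_mul, Real.norm_eq_abs, Real.norm_eq_abs, sq_abs, sq_abs]
  refine mul_le_of_le_one_left (sq_nonneg _) ?_
  have := sq_le_one_iff_abs_le_one a |>.2 h1
  nlinarith

end TestFunction

theorem norm_testPair_smoothPosPart_sq_add_le {δ : ℝ} (hδ : 0 < δ) (φ : 𝓓(Ω, ℝ)) :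
    ‖(testPair Ω (φ.smoothPosPart δ hδ)).2‖ ^ 2 + ‖(testPair Ω ((-φ).smoothPosPart δ hδ)).2‖ ^ 2 ≤
      ‖(testPair Ω φ).2‖ ^ 2 := by
  have hint : ∀ ψ : 𝓓(Ω, ℝ), Integrable (fun x => ‖∇ ψ x‖ ^ 2) (volume.restrict Ω) := fun ψ =>
    ψ.memLp_gradient.integrable_norm_pow (by norm_num)
  have hsq : ∀ ψ : 𝓓(Ω, ℝ), ‖(testPair Ω ψ).2‖ ^ 2 = ∫ x in Ω, ‖∇ ψ x‖ ^ 2 := fun ψ => by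
    rw [Lp.norm_sq_eq_integral]
    exact integral_congr_ae ((testPair_snd_ae ψ).mono fun x hx => by simp only [hx])
  rw [hsq, hsq, hsq, ← integral_add (hint _) (hint _)]
  exact integral_mono ((hint _).add (hint _)) (hint _)
    fun x => φ.norm_gradient_smoothPosPart_sq_add_le hδ x

/-- The smoothing error is at most δ uniformly, hence small in L² on a finite measure space, and the
positive part is continuous on L². -/
theorem tendsto_testPair_smoothPosPart
    [IsFiniteMeasure (volume.restrict (Ω : Set (EuclideanSpace ℝ (Fin d))))]
    {φ : ℕ → 𝓓(Ω, ℝ)} {u : Lp ℝ 2 (volume.restrict (Ω : Set (EuclideanSpace ℝ (Fin d))))}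
    (hφ : Tendsto (fun n => (testPair Ω (φ n)).1) atTop (𝓝 u)) {δ : ℕ → ℝ} (hδ : ∀ n, 0 < δ n)
    (hδ0 : Tendsto δ atTop (𝓝 0)) :
    Tendsto (fun n => (testPair Ω ((φ n).smoothPosPart (δ n) (hδ n))).1) atTop
      (𝓝 (Lp.posPart u)) := by
  have h1 : Tendsto (fun n => Lp.posPart (testPair Ω (φ n)).1) atTop (𝓝 (Lp.posPart u)) :=
    (Lp.continuous_posPart.tendsto u).comp hφ
  have h2 : Tendsto (fun n => (testPair Ω ((φ n).smoothPosPart (δ n) (hδ n))).1 -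
      Lp.posPart (testPair Ω (φ n)).1) atTop (𝓝 0) := by
    refine squeeze_zero_norm (fun n => Lp.norm_le_of_ae_bound (hδ n).le ?_)
      (by simpa using hδ0.const_mul _)
    filter_upwards [Lp.coeFn_sub (testPair Ω ((φ n).smoothPosPart (δ n) (hδ n))).1
      (Lp.posPart (testPair Ω (φ n)).1), Lp.coeFn_posPart (testPair Ω (φ n)).1,
      testPair_fst_ae (φ n), testPair_fst_ae ((φ n).smoothPosPart (δ n) (hδ n))]
      with x hx1 hx2 hx3 hx4
    rw [hx1, Pi.sub_apply, hx2, hx3, hx4]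
    exact (φ n).abs_smoothPosPart_sub_le (hδ n) x
  simpa using h2.add h1

theorem norm_sq_posPart_add {α : Type*} [MeasurableSpace α] {μ : Measure α} (u : Lp ℝ 2 μ) :
    ‖Lp.posPart u‖ ^ 2 + ‖Lp.posPart (-u)‖ ^ 2 = ‖u‖ ^ 2 := by
  rw [Lp.norm_sq_eq_integral, Lp.norm_sq_eq_integral, Lp.norm_sq_eq_integral,
    ← integral_add ((Lp.memLp _).integrable_norm_pow (by norm_num))
      ((Lp.memLp _).integrable_norm_pow (by norm_num))]
  refine integral_congr_ae ?_
  filter_upwards [Lp.coeFn_posPart u, Lp.coeFn_posPart (-u), Lp.coeFn_neg u] with x h1 h2 h3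
  simp only [h1, h2, h3, Pi.neg_apply]
  rcases le_total 0 (u x) with h | h
  · rw [max_eq_left h, max_eq_right (by linarith)]
    simp
  · rw [max_eq_right h, max_eq_left (by linarith)]
    simp

/-- The positive part of a minimizer of the Rayleigh quotient is a minimizer. -/
theorem exists_mem_sobolevZero_posPart
    [IsFiniteMeasure (volume.restrict (Ω : Set (EuclideanSpace ℝ (Fin d))))] {c : ℝ}
    (hc : ∀ p ∈ sobolevZero Ω, c * ‖p.1‖ ^ 2 ≤ ‖p.2‖ ^ 2) {p} (hp : p ∈ sobolevZero Ω)
    (hmin : ‖p.2‖ ^ 2 = c * ‖p.1‖ ^ 2) :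
    ∃ G, (Lp.posPart p.1, G) ∈ sobolevZero Ω ∧ ‖G‖ ^ 2 = c * ‖Lp.posPart p.1‖ ^ 2 := by
  obtain ⟨φ, hφ⟩ := exists_tendsto_of_mem_sobolevZero hp
  have hφ1 : Tendsto (fun n => (testPair Ω (φ n)).1) atTop (𝓝 p.1) :=
    (continuous_fst.tendsto p).comp hφ
  have hφ2 : Tendsto (fun n => (testPair Ω (φ n)).2) atTop (𝓝 p.2) :=
    (continuous_snd.tendsto p).comp hφ
  have hδ : ∀ n : ℕ, 0 < 1 / ((n : ℝ) + 1) := fun n => by positivity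
  have hA := tendsto_testPair_smoothPosPart hφ1 hδ tendsto_one_div_add_atTop_nhds_zero_nat
  have hB := tendsto_testPair_smoothPosPart (φ := fun n => -φ n) (u := -p.1)
    (by simpa using hφ1.neg) hδ tendsto_one_div_add_atTop_nhds_zero_nat
  refine exists_mem_of_tendsto_minimizing isClosed_sobolevZero hc
    (fun n => testPair_mem_sobolevZero ((φ n).smoothPosPart _ (hδ n))) hA ?_
  -- Squeeze: the energy of the smoothed positive part is at least c times its squared L² norm, and
  -- at most the energy of φₙ minus c times the squared norm of the smoothed negative part. Both
  -- bounds tend to c‖u⁺‖² since ‖u‖² = ‖u⁺‖² + ‖u⁻‖².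
  refine tendsto_of_tendsto_of_tendsto_of_le_of_le
    (g := fun n => c * ‖(testPair Ω ((φ n).smoothPosPart _ (hδ n))).1‖ ^ 2)
    (h := fun n => ‖(testPair Ω (φ n)).2‖ ^ 2 -
      c * ‖(testPair Ω ((-φ n).smoothPosPart _ (hδ n))).1‖ ^ 2) ((hA.norm.pow 2).const_mul c) ?_
    (fun n => hc _ (testPair_mem_sobolevZero _)) fun n => ?_
  · have h := (hφ2.norm.pow 2).sub ((hB.norm.pow 2).const_mul c)
    rwa [hmin, ← norm_sq_posPart_add p.1, mul_add, add_sub_cancel_right] at h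
  · have h1 := norm_testPair_smoothPosPart_sq_add_le (hδ n) (φ n)
    have h2 := hc _ (testPair_mem_sobolevZero ((-φ n).smoothPosPart _ (hδ n)))
    linarith

/-- A nonnegative eigenfunction with nonnegative eigenvalue is superharmonic. -/
theorem integral_indicator_mul_laplace_nonpos {c : ℝ} (hc : 0 ≤ c) {p} (hp : p ∈ sobolevZero Ω)
    (hev : ∀ q ∈ sobolevZero Ω, inner ℝ p.2 q.2 = c * inner ℝ p.1 q.1)
    (hp0 : 0 ≤ᵐ[volume.restrict (Ω : Set (EuclideanSpace ℝ (Fin d)))] p.1)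
    (ψ : 𝓓(Ω, ℝ)) (hψ : ∀ y, 0 ≤ ψ y) :
    ∫ y, (Ω : Set (EuclideanSpace ℝ (Fin d))).indicator p.1 y * laplace ψ y ≤ 0 := by
  have h1 : ∫ y, (Ω : Set (EuclideanSpace ℝ (Fin d))).indicator p.1 y * laplace ψ y =
      ∫ y in Ω, p.1 y * laplace ψ y := by
    rw [← integral_indicator Ω.isOpen.measurableSet]
    simp only [Set.indicator_mul_left]
  set e : Fin d → EuclideanSpace ℝ (Fin d) := fun i => EuclideanSpace.single i 1 with he
  -- The weak gradient identity is applied to the test function ∂ᵢψ.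
  have h2 : ∀ i, ∫ y in Ω, p.1 y * fderiv ℝ (fun z => fderiv ℝ ψ z (e i)) y (e i) =
      - ∫ y in Ω, inner ℝ (p.2 y) (e i) * inner ℝ (∇ ψ y) (e i) := fun i => by
    have h := integral_mul_inner_gradient_of_mem_sobolevZero hp (ψ.dirDeriv (e i)) (e i)
    simp only [inner_gradient_eq_fderiv _ _ (e i), ψ.dirDeriv_apply] at h ⊢
    exact h
  have hint1 : ∀ i, Integrable (fun y => p.1 y * fderiv ℝ (fun z => fderiv ℝ ψ z (e i)) y (e i))
      (volume.restrict Ω) := fun i =>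
    (Lp.memLp p.1).integrable_mul ((ψ.dirDeriv (e i)).dirDeriv (e i)).memLp
  have hint2 : ∀ i, Integrable (fun y => inner ℝ (p.2 y) (e i) * inner ℝ (∇ ψ y) (e i))
      (volume.restrict Ω) := fun i =>
    ((Lp.memLp p.2).inner_const (e i)).integrable_mul (ψ.memLp_gradient.inner_const (e i))
  have h3 : ∫ y in Ω, p.1 y * laplace ψ y = - ∫ y in Ω, inner ℝ (p.2 y) (∇ ψ y) := by
    simp only [laplace, Finset.mul_sum]
    rw [integral_finsetSum _ fun i _ => hint1 i]
    rw [Finset.sum_congr rfl fun i _ => h2 i, Finset.sum_neg_distrib,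
      ← integral_finsetSum _ fun i _ => hint2 i]
    congr 2
    ext y
    rw [← (EuclideanSpace.basisFun (Fin d) ℝ).sum_inner_mul_inner (p.2 y) (∇ ψ y)]
    refine Finset.sum_congr rfl fun i _ => ?_
    rw [EuclideanSpace.basisFun_apply, real_inner_comm (∇ ψ y)]
  have h4 := hev _ (testPair_mem_sobolevZero ψ)
  have h5 : inner ℝ p.2 (testPair Ω ψ).2 = ∫ y in Ω, inner ℝ (p.2 y) (∇ ψ y) := by
    rw [L2.inner_def]
    exact integral_congr_ae ((testPair_snd_ae ψ).mono fun x hx => by simp only [hx])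
  have h6 : 0 ≤ inner ℝ p.1 (testPair Ω ψ).1 := by
    rw [L2.inner_def]
    refine integral_nonneg_of_ae ?_
    filter_upwards [hp0, testPair_fst_ae ψ] with x hx hx'
    rw [hx']
    simpa using mul_nonneg (hψ x) hx
  rw [h1, h3, ← h5, h4]
  have := mul_nonneg hc h6
  linarith

/-- A minimizer of the Rayleigh quotient with nonzero positive part is positive. -/
theorem ae_pos_of_rayleigh_minimizer
    [IsFiniteMeasure (volume.restrict (Ω : Set (EuclideanSpace ℝ (Fin d))))]
    (hΩ : IsPreconnected (Ω : Set (EuclideanSpace ℝ (Fin d)))) {c : ℝ}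
    (hc : ∀ p ∈ sobolevZero Ω, c * ‖p.1‖ ^ 2 ≤ ‖p.2‖ ^ 2) {p} (hp : p ∈ sobolevZero Ω)
    (hmin : ‖p.2‖ ^ 2 = c * ‖p.1‖ ^ 2) (hne : Lp.posPart p.1 ≠ 0) :
    ∀ᵐ x ∂(volume.restrict (Ω : Set (EuclideanSpace ℝ (Fin d)))), 0 < p.1 x := by
  obtain ⟨G, hG, hGmin⟩ := exists_mem_sobolevZero_posPart hc hp hmin
  -- Superharmonicity needs c ≥ 0, which follows from 0 ≤ ‖G‖² = c‖u⁺‖² with u⁺ ≠ 0.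
  have hc0 : 0 ≤ c := by
    by_contra h
    have h1 : 0 < ‖Lp.posPart p.1‖ ^ 2 := by positivity
    nlinarith [sq_nonneg ‖G‖]
  have hpos : 0 ≤ᵐ[volume.restrict (Ω : Set (EuclideanSpace ℝ (Fin d)))] Lp.posPart p.1 := by
    filter_upwards [Lp.coeFn_posPart p.1] with x hx
    rw [hx]
    exact le_max_right _ _
  have hΩm : MeasurableSet (Ω : Set (EuclideanSpace ℝ (Fin d))) := Ω.isOpen.measurableSet
  have hW0 : ∀ᵐ x, 0 ≤ (Ω : Set (EuclideanSpace ℝ (Fin d))).indicator (Lp.posPart p.1) x := by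
    filter_upwards [(ae_restrict_iff' hΩm).1 hpos] with x hx
    exact Set.indicator_apply_nonneg hx
  rcases ae_eq_zero_or_pos_of_superharmonic hΩ
    (W := (Ω : Set (EuclideanSpace ℝ (Fin d))).indicator (Lp.posPart p.1))
    ((integrable_indicator_iff hΩm).2 ((Lp.memLp (Lp.posPart p.1)).integrable (by norm_num)))
    hW0 (integral_indicator_mul_laplace_nonpos hc0 hG
      (fun q hq => inner_eq_of_rayleigh_minimizer hc hG hGmin hq) hpos) with h | h
  · refine absurd ?_ hne
    rw [Lp.eq_zero_iff_ae_eq_zero]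
    refine (ae_restrict_iff' hΩm).2 ?_
    filter_upwards [h] with x hx hxΩ
    simpa [Set.indicator_of_mem hxΩ] using hx hxΩ
  · filter_upwards [(ae_restrict_iff' hΩm).2 h, Lp.coeFn_posPart p.1, ae_restrict_mem hΩm]
      with x hx hx' hxΩ
    rw [Set.indicator_of_mem hxΩ, hx'] at hx
    simpa using hx

theorem inner_ne_zero_of_ae_pos
    {α : Type*} [MeasurableSpace α] {μ : Measure α} {f g : Lp ℝ 2 μ}
    (hf : ∀ᵐ x ∂μ, 0 < f x) (hg : ∀ᵐ x ∂μ, 0 < g x) (hf0 : f ≠ 0) : inner ℝ g f ≠ 0 := by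
  intro h
  rw [L2.inner_def, integral_eq_zero_iff_of_nonneg_ae ?_ (L2.integrable_inner g f)] at h
  · refine hf0 ((Lp.eq_zero_iff_ae_eq_zero).2 ?_)
    filter_upwards [h, hf, hg] with x hx hfx hgx
    simp only [RCLike.inner_apply, conj_trivial, Pi.zero_apply] at hx
    exact absurd hx (mul_pos hfx hgx).ne'
  · filter_upwards [hf, hg] with x hfx hgx
    simpa using (mul_pos hfx hgx).le

/-- A minimizer of the Rayleigh quotient is not orthogonal to a positive function. -/
theorem inner_ne_zero_of_rayleigh_minimizer
    [IsFiniteMeasure (volume.restrict (Ω : Set (EuclideanSpace ℝ (Fin d))))]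
    (hΩ : IsPreconnected (Ω : Set (EuclideanSpace ℝ (Fin d)))) {c : ℝ}
    (hc : ∀ p ∈ sobolevZero Ω, c * ‖p.1‖ ^ 2 ≤ ‖p.2‖ ^ 2) {p} (hp : p ∈ sobolevZero Ω)
    (hmin : ‖p.2‖ ^ 2 = c * ‖p.1‖ ^ 2) (hne : p.1 ≠ 0)
    {g : Lp ℝ 2 (volume.restrict (Ω : Set (EuclideanSpace ℝ (Fin d))))}
    (hg : ∀ᵐ x ∂(volume.restrict (Ω : Set (EuclideanSpace ℝ (Fin d)))), 0 < g x) :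
    inner ℝ g p.1 ≠ 0 := by
  by_cases h : Lp.posPart p.1 = 0
  -- If u⁺ = 0 then -u has nonzero positive part, and -u is also a minimizer.
  · have h' : Lp.posPart (-p).1 ≠ 0 := fun h' => by
      have := norm_sq_posPart_add p.1
      rw [h, ← Prod.fst_neg, h'] at this
      exact hne (by simpa using this.symm)
    have hpos := ae_pos_of_rayleigh_minimizer hΩ hc ((sobolevZero Ω).neg_mem hp)
      (by simpa using hmin) h'
    have := inner_ne_zero_of_ae_pos hpos hg (by simpa using hne)
    simpa using this
  · exact inner_ne_zero_of_ae_pos (ae_pos_of_rayleigh_minimizer hΩ hc hp hmin h) hg hne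

theorem exists_testFunction_bump {x : EuclideanSpace ℝ (Fin d)} {r : ℝ} (hr : 0 < r)
    (hx : Metric.closedBall x r ⊆ Ω) :
    ∃ φ : 𝓓(Ω, ℝ), φ x = 1 ∧ ∀ y, r ≤ dist y x → φ y = 0 := by
  let f : ContDiffBump x := ⟨r / 2, r, by positivity, by linarith⟩
  refine ⟨⟨f, f.contDiff, f.hasCompactSupport, ?_⟩, ?_, fun y hy => f.zero_of_le_dist hy⟩
  · rw [f.tsupport_eq]
    exact hx
  · exact f.one_of_mem_closedBall (Metric.mem_closedBall_self f.rIn_pos.le)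

theorem testPair_fst_ne_zero {φ : 𝓓(Ω, ℝ)} {x : EuclideanSpace ℝ (Fin d)} (hx : φ x ≠ 0) :
    (testPair Ω φ).1 ≠ 0 := by
  intro h
  rw [Lp.eq_zero_iff_ae_eq_zero] at h
  have hxΩ : x ∈ Ω := by
    by_contra h'
    exact hx (φ.eq_zero_of_notMem h')
  have := Measure.eqOn_open_of_ae_eq ((testPair_fst_ae φ).symm.trans h) Ω.isOpen
    φ.continuous.continuousOn continuousOn_const
  exact hx (this hxΩ)

/-- There are nonzero test functions orthogonal to any given function. -/
theorem exists_testFunction_inner_eq_zero (hd : 0 < d)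
    (hΩ : (Ω : Set (EuclideanSpace ℝ (Fin d))).Nonempty)
    (g : Lp ℝ 2 (volume.restrict (Ω : Set (EuclideanSpace ℝ (Fin d))))) :
    ∃ φ : 𝓓(Ω, ℝ), inner ℝ g (testPair Ω φ).1 = 0 ∧ (testPair Ω φ).1 ≠ 0 := by
  obtain ⟨x, hx⟩ := hΩ
  obtain ⟨ρ, hρ, hball⟩ := Metric.isOpen_iff.1 Ω.isOpen x hx
  set y : EuclideanSpace ℝ (Fin d) := x + EuclideanSpace.single ⟨0, hd⟩ (ρ / 2) with hy
  have hyx : dist y x = ρ / 2 := by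
    simp [hy, abs_of_pos hρ]
  obtain ⟨φ, hφ1, hφ0⟩ := exists_testFunction_bump (Ω := Ω) (x := x) (r := ρ / 4) (by positivity)
    ((Metric.closedBall_subset_ball (by linarith)).trans hball)
  obtain ⟨ψ, hψ1, hψ0⟩ := exists_testFunction_bump (Ω := Ω) (x := y) (r := ρ / 4) (by positivity)
    ((Metric.closedBall_subset_ball' (by linarith)).trans hball)
  have hφy : φ y = 0 := hφ0 y (by linarith)
  have hψx : ψ x = 0 := hψ0 x (by rw [dist_comm]; linarith)
  by_cases h : inner ℝ g (testPair Ω φ).1 = 0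
  · exact ⟨φ, h, testPair_fst_ne_zero (x := x) (by simp [hφ1])⟩
  -- This combination is orthogonal to g, and at y, where φ = 0 and ψ = 1, its value is -⟨g, φ⟩ ≠ 0.
  · refine ⟨inner ℝ g (testPair Ω ψ).1 • φ - inner ℝ g (testPair Ω φ).1 • ψ, ?_,
      testPair_fst_ne_zero (x := y) ?_⟩
    · simp only [map_sub, map_smul, Prod.fst_sub, Prod.smul_fst, inner_sub_right,
        inner_smul_right]
      ring
    · change inner ℝ g (testPair Ω ψ).1 * φ y - inner ℝ g (testPair Ω φ).1 * ψ y ≠ 0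
      rw [hφy, hψ1]
      simpa using h

end Eigenfunctions

/-! ### The strict inequality -/

theorem proposition3p2 (d : ℕ) (hd : 2 ≤ d) (Ω : Opens (EuclideanSpace ℝ (Fin d)))
    (hΩ_bdd : Bornology.IsBounded (Ω : Set (EuclideanSpace ℝ (Fin d))))
    (hΩ_conn : IsConnected (Ω : Set (EuclideanSpace ℝ (Fin d))))
    (g : EuclideanSpace ℝ (Fin d) → ℝ) (hg : IsLInftyPlus g) :
    IsLeast {μ : ℝ | IsDirichletEigenvalue Ω μ} (dirichletEigenvalue Ω) ∧
      IsLeast (twistedRayleighValues Ω g) (twistedEigenvalue Ω g) ∧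
      dirichletEigenvalue Ω < twistedEigenvalue Ω g := by
  have := isFiniteMeasure_restrict_of_isBounded hΩ_bdd
  have hgL : MemLp g 2 (volume.restrict (Ω : Set (EuclideanSpace ℝ (Fin d)))) :=
    (hg.1.restrict _).mono_exponent le_top
  have hgpos : ∀ᵐ x ∂(volume.restrict (Ω : Set (EuclideanSpace ℝ (Fin d)))), 0 < hgL.toLp g x := by
    filter_upwards [hgL.coeFn_toLp, ae_restrict_of_ae hg.2] with x hx hx'
    rw [hx]
    exact hx'.1
  obtain ⟨φ, hφg, hφ0⟩ := exists_testFunction_inner_eq_zero (by omega) hΩ_conn.nonempty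
    (hgL.toLp g)
  have hcpt := exists_subseq_tendsto_of_mem_sobolevZero hΩ_bdd
  obtain ⟨c, hc, p, hp, hp0, hpmin⟩ := exists_rayleigh_minimizer isClosed_sobolevZero hcpt
    ⟨_, testPair_mem_sobolevZero φ, hφ0⟩
  -- The twisted space: H¹₀(Ω) cut by the kernel of a continuous functional, so it stays closed and
  -- inherits Rellich compactness.
  set V : Submodule ℝ (Lp ℝ 2 (volume.restrict (Ω : Set (EuclideanSpace ℝ (Fin d)))) ×
      Lp (EuclideanSpace ℝ (Fin d)) 2 (volume.restrict (Ω : Set (EuclideanSpace ℝ (Fin d))))) :=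
    sobolevZero Ω ⊓ LinearMap.ker ((innerSL ℝ (hgL.toLp g)).comp
      (ContinuousLinearMap.fst ℝ _ _)).toLinearMap with hV
  have hVmem : ∀ q, q ∈ V ↔ q ∈ sobolevZero Ω ∧ inner ℝ (hgL.toLp g) q.1 = 0 := fun q => by
    simp [hV]
  have hVc : IsClosed (V : Set (Lp ℝ 2 (volume.restrict (Ω : Set (EuclideanSpace ℝ (Fin d)))) ×
      Lp (EuclideanSpace ℝ (Fin d)) 2
        (volume.restrict (Ω : Set (EuclideanSpace ℝ (Fin d)))))) := by
    rw [hV, Submodule.coe_inf]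
    exact isClosed_sobolevZero.inter (ContinuousLinearMap.isClosed_ker _)
  obtain ⟨c', hc', q, hq, hq0, hqmin⟩ := exists_rayleigh_minimizer hVc
    (fun p hp => hcpt p fun n => ((hVmem _).1 (hp n)).1)
    ⟨_, (hVmem _).2 ⟨testPair_mem_sobolevZero φ, hφg⟩, hφ0⟩
  obtain ⟨hqV, hqg⟩ := (hVmem q).1 hq
  have h1 : IsLeast {μ : ℝ | IsDirichletEigenvalue Ω μ} c := by
    refine ⟨isDirichletEigenvalue_iff.2 ⟨p, hp, hp0, fun q hq =>
      inner_eq_of_rayleigh_minimizer hc hp hpmin hq⟩, fun μ hμ => ?_⟩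
    obtain ⟨r, hr, hr0, hev⟩ := isDirichletEigenvalue_iff.1 hμ
    have h2 := hev r hr
    rw [real_inner_self_eq_norm_sq, real_inner_self_eq_norm_sq] at h2
    have h3 := hc r hr
    rw [h2] at h3
    exact le_of_mul_le_mul_right h3 (by positivity)
  have h2 : IsLeast (twistedRayleighValues Ω g) c' := by
    refine ⟨(mem_twistedRayleighValues_iff hgL).2 ⟨q, hqV, hqg, hq0, ?_⟩, fun μ hμ => ?_⟩
    · rw [hqmin, mul_div_assoc, div_self (by positivity), mul_one]
    · obtain ⟨r, hr, hrg, hr0, rfl⟩ := (mem_twistedRayleighValues_iff hgL).1 hμ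
      rw [le_div_iff₀ (by positivity)]
      exact hc' r ((hVmem r).2 ⟨hr, hrg⟩)
  have e1 : dirichletEigenvalue Ω = c := h1.csInf_eq
  have e2 : twistedEigenvalue Ω g = c' := h2.csInf_eq
  rw [e1, e2]
  refine ⟨h1, h2, lt_of_le_of_ne ?_ ?_⟩
  · have h3 := hc q hqV
    rw [hqmin] at h3
    exact le_of_mul_le_mul_right h3 (by positivity)
  · intro h
    -- Under equality the twisted minimizer attains the minimum over all of H¹₀(Ω), so it cannot be
    -- orthogonal to g.
    rw [← h] at hqmin
    exact inner_ne_zero_of_rayleigh_minimizer hΩ_conn.isPreconnected hc hqV hqmin hq0 hgpos hqg
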